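/- Let $A$ be a group, let $C, D\le A$ be subgroups contained in the center of $A$, let $\varphi\colon C\to D$ be an isomorphism, and let $G=A*_C=\langle A,t\mid tct^{-1}=\varphi(c)\ (c\in C)\rangle$ be the HNN extension with stable letter $t$; so the edge groups $C$ and its conjugate $D$ by $t$ are central in $A$. Let $T$ be the associated Bass–Serre tree, regarded as a metric tree with edges of length one. The $t$-exponent is the homomorphism $G\to\mathbb Z$ sending $t$ to $1$ and $A$ to $0$. For $g\in G$ let $|g|=\inf_{x\in T}d(x,gx)$. The element $g$ is hyperbolic if $|g|>0$; then $T_g=\{x\in T: d(x,gx)=|g|\}$ is its axis, a line on which $g$ acts as a shift by $|g|$, oriented by the direction of this shift. A fundamental domain for $g$ is a segment of the form $[x,gx]$ contained in $T_g$, oriented from $x$ to $gx$, where $x$ may be any point of $T_g$ (not necessarily a vertex). For an oriented segment $\gamma$ of positive length in $T$, $\overline\gamma$ denotes the segment with the opposite orientation, and a copy of $\gamma$ is a translate $h\gamma$ with $h\in G$. Two segments overlap if they have more than one point in common. For hyperbolic $g$, let $c_\gamma(g)$ be the maximal number of pairwise non-overlapping copies in the circuit $T_g/\langle g\rangle$ of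 $\gamma$, i.e. images of copies of $\gamma$ that lie in $T_g$ and are positively oriented there (images of two segments of $T_g$ overlap if one of the segments overlaps some $\langle g\rangle$-translate of the other); this number is $0$ by convention if $\gamma$ is longer than $|g|$. For $g$ not hyperbolic let $c_\gamma(g)=0$. Put $$f_\gamma(g)=c_\gamma(g)-c_{\overline\gamma}(g),\qquad h_\gamma(g)=\lim_{n\to\infty}\frac{f_\gamma(g^n)}{n}.$$ **Theorem.** Let $g\in G$ be a hyperbolic element of $t$-exponent zero. Then at least one of the following holds: 1. there is a fundamental domain $\gamma$ for $g$ such that the limit $h_\gamma(g)$ exists and equals $1$; 2. there is an element $h\in G$ such that $h(T_g)=\overline{T}_g$, i.e. $h$ maps the axis $T_g$ onto itself and reverses its orientation. -/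

import Mathlib

/-! ### Groups acting on metric trees

`X` is the set of points of a tree (interior points of edges included), with its path metric
in which edges have length one, and `G` acts on it. -/

namespace GTree

/-- An oriented segment, given by its ordered pair of endpoints. -/
@[ext]
structure OSeg (X : Type*) where
  src : X
  tgt : X

section

variable {G X : Type*} [Group G] [MulAction G X] [Dist X]

/-- The underlying set of the segment `[x, y]`: the points `z` lying between `x` and `y`. -/
def OSeg.carrier (γ : OSeg X) : Set X :=
  {z | dist γ.src z + dist z γ.tgt = dist γ.src γ.tgt}

/-- The length of a segment. -/
noncomputable def OSeg.length (γ : OSeg X) : ℝ := dist γ.src γ.tgt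

/-- The same segment with the opposite orientation. -/
def OSeg.reverse (γ : OSeg X) : OSeg X := ⟨γ.tgt, γ.src⟩

/-- The translate `g γ` of an oriented segment. -/
instance : SMul G (OSeg X) := ⟨fun g γ => ⟨g • γ.src, g • γ.tgt⟩⟩

/-- Two segments overlap if their intersection (a segment, in a tree) has more than one point. -/
def OSeg.Overlap (γ δ : OSeg X) : Prop := (γ.carrier ∩ δ.carrier).Nontrivial

variable (X) in
/-- The translation length `|g|`, the infimum of the displacement of `g`. -/
noncomputable def translationLength (g : G) : ℝ := ⨅ x : X, dist x (g • x)

variable (X) in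
/-- `g` is hyperbolic if its translation length is positive; otherwise it is elliptic. -/
def IsHyperbolic (g : G) : Prop := 0 < translationLength X g

variable (X) in
/-- The characteristic subtree `T_g`: the points where the displacement of `g` is minimal.
For hyperbolic `g` it is the axis of `g`. -/
def axis (g : G) : Set X := {x | ∀ y : X, dist x (g • x) ≤ dist y (g • y)}

/-- The natural orientation of the axis of a hyperbolic element `g`, as an order relation on its
points: `x` comes before `y` in the direction of the shift by `g` (or `x = y`). -/
def AxisLE (g : G) (x y : X) : Prop :=
  x ∈ axis X g ∧ y ∈ axis X g ∧ ∃ n : ℕ, y ∈ (OSeg.mk x (g ^ n • x)).carrier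

/-- `γ` is a fundamental domain for the hyperbolic element `g`, oriented as the axis: a segment
`[x, g x]` contained in the axis of `g`, where `x` may be any point, not only a vertex. -/
def IsFundamentalDomain (g : G) (γ : OSeg X) : Prop :=
  γ.carrier ⊆ axis X g ∧ γ.tgt = g • γ.src

/-- `σ` is a copy `h γ` of `γ` that lies in the axis of `g` and is positively oriented there. -/
def IsPositiveCopy (g : G) (γ σ : OSeg X) : Prop :=
  (∃ h : G, σ = h • γ) ∧ σ.carrier ⊆ axis X g ∧ AxisLE g σ.src σ.tgt

open Classical in
/-- `c_γ(g)`: for hyperbolic `g`, the maximal number of pairwise non-overlapping positively oriented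
copies of `γ` in the circuit `T_g / ⟨g⟩`; there are none if `γ` is longer than the circuit. Copies in
the circuit are represented by lifts `σ i` to the axis; the images of two segments of the axis
overlap in the circuit exactly if one of them overlaps with some `⟨g⟩`-translate of the other.
For elliptic `g` the value is `0`. (For a segment `γ` of positive length the set of numbers below is
bounded, by `|g| / |γ|`.) -/
noncomputable def copyCount (γ : OSeg X) (g : G) : ℕ :=
  if IsHyperbolic X g ∧ γ.length ≤ translationLength X g then
    sSup {k : ℕ | ∃ σ : Fin k → OSeg X, (∀ i, IsPositiveCopy g γ (σ i)) ∧
      ∀ i j, i ≠ j → ∀ m : ℤ, ¬ (σ i).Overlap (g ^ m • σ j)}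
  else 0

/-- `f_γ(g) = c_γ(g) - c_{γ reversed}(g)`. -/
noncomputable def copyDiff (γ : OSeg X) (g : G) : ℝ :=
  (copyCount γ g : ℝ) - (copyCount γ.reverse g : ℝ)

/-- `h_γ(g) = r`, where `h_γ(g)` is the limit of `f_γ(g ^ n) / n`: the limit exists and is `r`. -/
def HomogenizationEq (γ : OSeg X) (g : G) (r : ℝ) : Prop :=
  Filter.Tendsto (fun n : ℕ => copyDiff γ (g ^ n) / (n : ℝ)) Filter.atTop (nhds r)

variable (X) in
/-- `h` maps the axis of `g` onto itself, reversing its natural orientation. -/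
def ReversesAxis (h g : G) : Prop :=
  (fun x : X => h • x) '' axis X g = axis X g ∧
    ∀ x y : X, AxisLE g x y → AxisLE g (h • y) (h • x)

end

end GTree

/-! ### The Bass-Serre tree of an HNN extension

The HNN extension of `A` with stable letter `t`, where `t * c * t⁻¹ = φ c` for `c ∈ C`. The edge
groups are `C` and its conjugate `D = t C t⁻¹`. -/

namespace BassSerre

section

variable {A : Type*} [Group A] {C D : Subgroup A} (φ : C ≃* D)

/-- The `t`-exponent homomorphism, sending `t` to `1` and `A` to `0`. -/
def tExponent : HNNExtension A C D φ →* Multiplicative ℤ :=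
  HNNExtension.lift 1 (Multiplicative.ofAdd 1) (by intro a; simp)

/-- The vertices: left cosets of (the image of) `A`. -/
abbrev Vertex : Type _ :=
  HNNExtension A C D φ ⧸ (HNNExtension.of : A →* HNNExtension A C D φ).range

/-- The (oriented) edges: left cosets of (the image of) `C`. -/
abbrev Edge : Type _ :=
  HNNExtension A C D φ ⧸ C.map (HNNExtension.of : A →* HNNExtension A C D φ)

variable {φ}

/-- The edge `g C` starts at the vertex `g t⁻¹ A`. -/
def Edge.origin : Edge φ → Vertex φ :=
  Quotient.map' (fun g => g * HNNExtension.t⁻¹) (by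
    intro a b hab
    rw [QuotientGroup.leftRel_apply] at hab ⊢
    obtain ⟨c, hc, h⟩ := hab
    refine ⟨(φ ⟨c, hc⟩ : A), ?_⟩
    rw [HNNExtension.equiv_eq_conj]
    simp only [h]
    group)

/-- The edge `g C` ends at the vertex `g A`. -/
def Edge.terminus : Edge φ → Vertex φ :=
  Quotient.map' (fun g => g) (by
    intro a b hab
    rw [QuotientGroup.leftRel_apply] at hab ⊢
    obtain ⟨c, -, h⟩ := hab
    exact ⟨c, h⟩)

variable (φ) in
/-- The underlying simple graph: two vertices are adjacent if they are joined by an edge. -/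
def graph : SimpleGraph (Vertex φ) :=
  SimpleGraph.fromRel (fun v w => ∃ e : Edge φ, e.origin = v ∧ e.terminus = w)

variable (φ) in
/-- The points of the Bass-Serre tree: the vertices, and for every edge `e` the interior points
of `e`, parametrized by their distance `s` from the origin of `e`. -/
inductive Tree : Type _
  | vertex (v : Vertex φ) : Tree
  | edge (e : Edge φ) (s : Set.Ioo (0 : ℝ) 1) : Tree

/-- The action of the HNN extension by left multiplication on cosets. -/
instance : MulAction (HNNExtension A C D φ) (Tree φ) where
  smul g x := match x with
    | .vertex v => .vertex (g • v)
    | .edge e s => .edge (g • e) s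
  one_smul x := by
    cases x with
    | vertex v => exact congrArg Tree.vertex (one_smul _ v)
    | edge e s => exact congrArg (fun e' => Tree.edge e' s) (one_smul _ e)
  mul_smul g h x := by
    cases x with
    | vertex v => exact congrArg Tree.vertex (mul_smul g h v)
    | edge e s => exact congrArg (fun e' => Tree.edge e' s) (mul_smul g h e)

/-- The distance from a vertex to a point of the tree. -/
noncomputable def vertexDist (v : Vertex φ) : Tree φ → ℝ
  | .vertex w => ((graph φ).dist v w : ℝ)
  | .edge e s => min (((graph φ).dist v e.origin : ℝ) + s)
      (((graph φ).dist v e.terminus : ℝ) + (1 - s))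

open Classical in
/-- The path metric of the tree, in which every edge has length one. A path between interior points
of different edges leaves the first edge through one of its endpoints. -/
noncomputable def treeDist : Tree φ → Tree φ → ℝ
  | .vertex v, y => vertexDist v y
  | .edge e s, .vertex w => vertexDist w (.edge e s)
  | .edge e s, .edge e' s' =>
      if e = e' then |(s : ℝ) - s'|
      else min (s + vertexDist e.origin (.edge e' s'))
        ((1 - s) + vertexDist e.terminus (.edge e' s'))

noncomputable instance : Dist (Tree φ) := ⟨treeDist⟩

end

end BassSerre

/-! Since `g` has `t`-exponent zero, the height of vertices is `L`-periodic along its axis `v : ℤ →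
Vertex φ`, where `g • v i = v (i + L)`; so it attains a maximum and a minimum on the axis.

Consider the fundamental domains `γ = [v x, v (x + L)]`. If for some `x` no element of the group
carries `γ` into the axis with reversed direction, then the circuit of `g ^ n` contains `n` disjoint
copies of `γ` and none of its reverse, so `f_γ(g ^ n) = n` and the first alternative holds.
Otherwise every segment of length `L` between vertices is reversible, and the whole axis must be
shown to be reversible (`Periodic.exists_reversal`).

Centrality enters through rigidity (`smul_eq_of_smul_eq_on`). An element fixing a vertex acts there
as some `a : A`; going down a fixed edge replaces `a` by `φ a`, with no conjugation because edge
groups are central. Hence along a path the label depends on height alone, and an element fixing a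
segment that reaches both the maximal and the minimal height fixes the whole axis.

Let `p` reverse `[x, x + L]` with `x` a maximum, by `v k ↦ v (R - k)`. Cut the axis into windows
between consecutive minima, and give each window the orbit of its pair of ends as its type. A
reversal of a period starting at a minimum shows that the multiset of types in a period is invariant
under swapping. The reflection induced by `p` swaps the types of all windows but the one straddling
`x + L`; by counting (`Finset.apply_eq_of_forall_ne`) it swaps that one too. So some `h` reflects
the straddling window by the same `R`. By rigidity `h` agrees with `p` on the axis, so `p` reflects
a segment that extends past `x + L` to the next minimum. There `p⁻¹ * g * p * g` fixes a maximum and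
a minimum, hence the whole axis, and `p` reverses the axis. -/

namespace BassSerre

/-! ### The Bass–Serre graph: heights, and Britton's lemma makes it a tree -/

section

variable {A : Type*} [Group A] {C D : Subgroup A} {φ : C ≃* D}

open HNNExtension

/-- The `t`-exponent of any representative of a vertex. -/
def height : Vertex φ → ℤ :=
  Quotient.lift (fun g => (tExponent φ g).toAdd) (by
    intro a b hab
    change QuotientGroup.leftRel _ a b at hab
    rw [QuotientGroup.leftRel_apply] at hab
    obtain ⟨c, hc⟩ := hab
    have h : tExponent φ (a⁻¹ * b) = 1 := by rw [← hc]; simp [tExponent]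
    rw [map_mul, map_inv, inv_mul_eq_one] at h
    simp only [h])

theorem height_mk (x : HNNExtension A C D φ) :
    height (x : Vertex φ) = (tExponent φ x).toAdd := rfl

theorem height_smul (g : HNNExtension A C D φ) (v : Vertex φ) :
    height (g • v) = (tExponent φ g).toAdd + height v := by
  induction v using QuotientGroup.induction_on with
  | H x => rw [MulAction.Quotient.smul_coe, height_mk, height_mk, smul_eq_mul, map_mul, toAdd_mul]

theorem origin_mk (x : HNNExtension A C D φ) :
    Edge.origin (x : Edge φ) = ((x * t⁻¹ : HNNExtension A C D φ) : Vertex φ) := rfl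

theorem terminus_mk (x : HNNExtension A C D φ) :
    Edge.terminus (x : Edge φ) = (x : Vertex φ) := rfl

theorem origin_smul (g : HNNExtension A C D φ) (e : Edge φ) :
    (g • e).origin = g • e.origin := by
  induction e using QuotientGroup.induction_on with
  | H x => simp only [MulAction.Quotient.smul_coe, origin_mk, smul_eq_mul, mul_assoc]

theorem terminus_smul (g : HNNExtension A C D φ) (e : Edge φ) :
    (g • e).terminus = g • e.terminus := by
  induction e using QuotientGroup.induction_on with
  | H x => simp only [MulAction.Quotient.smul_coe, terminus_mk]

theorem height_terminus (e : Edge φ) : height e.terminus = height e.origin + 1 := by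
  induction e using QuotientGroup.induction_on with
  | H x => simp [origin_mk, terminus_mk, height_mk, tExponent]

/-- The inequality built into `SimpleGraph.fromRel` is automatic, since the ends of an edge have
different heights. -/
theorem adj_iff {v w : Vertex φ} : (graph φ).Adj v w ↔
    ∃ e : Edge φ, (e.origin = v ∧ e.terminus = w) ∨ (e.origin = w ∧ e.terminus = v) := by
  rw [graph, SimpleGraph.fromRel_adj, ← exists_or]
  refine ⟨fun h => h.2, fun h => ⟨?_, h⟩⟩
  rintro rfl
  obtain ⟨e, ⟨h1, h2⟩ | ⟨h1, h2⟩⟩ := h <;>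
  · have := height_terminus e
    rw [h1, h2] at this
    omega

theorem adj_smul (g : HNNExtension A C D φ) {v w : Vertex φ} (h : (graph φ).Adj v w) :
    (graph φ).Adj (g • v) (g • w) := by
  rw [adj_iff] at h ⊢
  obtain ⟨e, h⟩ := h
  refine ⟨g • e, ?_⟩
  rw [origin_smul, terminus_smul]
  rcases h with ⟨rfl, rfl⟩ | ⟨rfl, rfl⟩
  · exact .inl ⟨rfl, rfl⟩
  · exact .inr ⟨rfl, rfl⟩

variable (φ) in
/-- The action on the vertices by graph automorphisms. -/
def smulIso (g : HNNExtension A C D φ) : graph φ ≃g graph φ where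
  toEquiv := MulAction.toPerm g
  map_rel_iff' := by
    intro v w
    refine ⟨fun h => ?_, adj_smul g⟩
    simpa using adj_smul g⁻¹ h

theorem mk_eq_iff {x y : HNNExtension A C D φ} :
    (x : Vertex φ) = y ↔ ∃ a : A, y = x * of a := by
  rw [QuotientGroup.eq]
  constructor
  · rintro ⟨a, ha⟩
    exact ⟨a, by rw [ha]; group⟩
  · rintro ⟨a, rfl⟩
    exact ⟨a, by group⟩

theorem exists_of_adj {x : HNNExtension A C D φ} {w : Vertex φ} (h : (graph φ).Adj x w) :
    ∃ (a : A) (u : ℤˣ), w = ((x * of a * t ^ (u : ℤ) : HNNExtension A C D φ) : Vertex φ) := by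
  rw [adj_iff] at h
  obtain ⟨e, h⟩ := h
  induction e using QuotientGroup.induction_on with
  | H y =>
    rw [origin_mk, terminus_mk] at h
    rcases h with ⟨h1, rfl⟩ | ⟨rfl, h2⟩
    · obtain ⟨a, ha⟩ := mk_eq_iff.1 h1.symm
      refine ⟨a, 1, ?_⟩
      rw [← ha]
      simp
    · obtain ⟨a, ha⟩ := mk_eq_iff.1 h2.symm
      exact ⟨a, -1, by rw [← ha]; simp⟩

theorem adj_mul_t (x : HNNExtension A C D φ) :
    (graph φ).Adj (x : Vertex φ) ((x * t : HNNExtension A C D φ) : Vertex φ) :=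
  adj_iff.2 ⟨((x * t : HNNExtension A C D φ) : Edge φ), .inl ⟨by simp [origin_mk], rfl⟩⟩

theorem reachable_mul (x y : HNNExtension A C D φ) :
    (graph φ).Reachable (x : Vertex φ) ((x * y : HNNExtension A C D φ) : Vertex φ) := by
  induction y using HNNExtension.induction_on generalizing x with
  | of a => rw [mk_eq_iff.2 ⟨a, rfl⟩]
  | t => exact (adj_mul_t x).reachable
  | mul y z hy hz => rw [← mul_assoc]; exact (hy x).trans (hz _)
  | inv y hy => simpa using (hy (x * y⁻¹)).symm

theorem graph_connected : (graph φ).Connected where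
  preconnected v w := by
    induction v using QuotientGroup.induction_on with
    | H x =>
      induction w using QuotientGroup.induction_on with
      | H y => simpa using reachable_mul x (x⁻¹ * y)
  nonempty := ⟨((1 : HNNExtension A C D φ) : Vertex φ)⟩

theorem t_zpow_mul_of_mul_t_zpow_neg (u : ℤˣ) {a : A} (ha : a ∈ toSubgroup C D u) :
    ∃ b : A, (t ^ (u : ℤ) * of a * t ^ (-(u : ℤ)) : HNNExtension A C D φ) = of b := by
  rcases Int.units_eq_one_or u with rfl | rfl
  · exact ⟨φ ⟨a, ha⟩, by rw [equiv_eq_conj]; simp⟩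
  · exact ⟨φ.symm ⟨a, ha⟩, by rw [equiv_symm_eq_conj]; simp⟩

/-- A walk spells a word in `A` and `t`, and a pinch in that word is exactly a backtracking of the
walk. The last clause records the second vertex of the walk, which the induction needs to detect a
pinch. -/
theorem exists_reducedWord_of_walk {v w : Vertex φ} (p : (graph φ).Walk v w)
    (hp : p.edges.IsChain (· ≠ ·)) (x : HNNExtension A C D φ) (hx : (x : Vertex φ) = v) :
    ∃ r : NormalWord.ReducedWord A C D, r.toList.length = p.length ∧
      ((x * r.prod φ : HNNExtension A C D φ) : Vertex φ) = w ∧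
      ∀ u ∈ r.toList.head?.map Prod.fst,
        p.snd = ((x * of r.head * t ^ (u : ℤ) : HNNExtension A C D φ) : Vertex φ) := by
  induction p generalizing x with
  | nil => exact ⟨.empty A C D, rfl, by simpa [NormalWord.ReducedWord.prod], by simp⟩
  | @cons v v' w h p ih =>
    subst hx
    obtain ⟨a, u, rfl⟩ := exists_of_adj h
    rw [SimpleGraph.Walk.edges_cons, List.isChain_cons] at hp
    obtain ⟨r, hr1, hr2, hr3⟩ := ih hp.2 _ rfl
    -- A pinch `t ^ u * of r.head * t ^ (-u)` lies in `A`, so the walk would return to its starting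
    -- vertex after two steps, along the same edge.
    have key : ∀ b ∈ r.toList.head?, r.head ∈ toSubgroup C D u → u = b.1 := by
      intro b hb hmem
      by_contra hne
      have hub : b.1 = -u := by
        rcases Int.units_eq_one_or u with rfl | rfl <;>
          rcases Int.units_eq_one_or b.1 with h | h <;> simp_all
      have hs := hr3 b.1 (by rw [Option.mem_def] at hb; simp [hb])
      obtain ⟨c, hc⟩ := t_zpow_mul_of_mul_t_zpow_neg (φ := φ) u hmem
      have hs' : p.snd = (x : Vertex φ) := by
        rw [hs, hub, eq_comm, mk_eq_iff]
        refine ⟨a * c, ?_⟩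
        rw [map_mul, ← hc]
        simp only [Units.val_neg, mul_assoc]
      cases p with
      | nil =>
        simp only [SimpleGraph.Walk.length_nil, List.length_eq_zero_iff] at hr1
        simp [hr1] at hb
      | cons h' q =>
        simp only [SimpleGraph.Walk.snd_cons] at hs'
        subst hs'
        have := hp.1 _ (by rw [SimpleGraph.Walk.edges_cons]; rfl)
        exact this Sym2.eq_swap
    refine ⟨⟨a, (u, r.head) :: r.toList, List.isChain_cons.2 ⟨key, r.chain⟩⟩, by simp [hr1], ?_, ?_⟩
    · rw [← hr2]
      simp [NormalWord.ReducedWord.prod, mul_assoc]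
    · simp

/-- A cycle would spell a nonempty reduced word with value in `A`, contrary to Britton's lemma. -/
theorem graph_isAcyclic : (graph φ).IsAcyclic := by
  intro v p hp
  induction v using QuotientGroup.induction_on with
  | H x =>
    obtain ⟨r, hr1, hr2, -⟩ :=
      exists_reducedWord_of_walk p (hp.isTrail.edges_nodup.isChain) x rfl
    obtain ⟨a, ha⟩ := mk_eq_iff.1 hr2.symm
    have := ReducedWord.toList_eq_nil_of_mem_of_range φ r ⟨a, mul_left_cancel ha.symm⟩
    rw [this] at hr1
    have := hp.three_le_length
    simp at hr1
    omega

theorem graph_isTree : (graph φ).IsTree := ⟨graph_connected, graph_isAcyclic⟩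

/-- **Britton's lemma** for the word `t a t⁻¹`. -/
theorem mem_of_t_mul_of_mul_inv_t {a b : A}
    (h : (t * of a * t⁻¹ : HNNExtension A C D φ) = of b) : a ∈ C := by
  by_contra ha
  have := ReducedWord.toList_eq_nil_of_mem_of_range φ
    ⟨1, [(1, a), (-1, 1)], by simp [ha]⟩
    ⟨b, by simp [NormalWord.ReducedWord.prod, ← h, mul_assoc]⟩
  simp at this

/-- There are no multiple edges, so nothing is lost by passing to a simple graph. -/
theorem edge_ext {e e' : Edge φ} (ho : e.origin = e'.origin) (ht : e.terminus = e'.terminus) :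
    e = e' := by
  induction e using QuotientGroup.induction_on with
  | H x =>
    induction e' using QuotientGroup.induction_on with
    | H y =>
      rw [terminus_mk, terminus_mk, mk_eq_iff] at ht
      rw [origin_mk, origin_mk, mk_eq_iff] at ho
      obtain ⟨a, rfl⟩ := ht
      obtain ⟨b, hb⟩ := ho
      rw [QuotientGroup.eq]
      have h : (t * of a * t⁻¹ : HNNExtension A C D φ) = of b := by
        have := congrArg (fun z => t * x⁻¹ * z) hb
        simpa [mul_assoc] using this
      exact ⟨a, mem_of_t_mul_of_mul_inv_t h, by simp⟩

end

end BassSerre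

/-! ### Geodesic lines in trees -/

namespace SimpleGraph

variable {V : Type*} {T : SimpleGraph V}

theorem IsTree.length_eq_dist (hT : T.IsTree) {a b : V} {p : T.Walk a b} (hp : p.IsPath) :
    p.length = T.dist a b := by
  obtain ⟨q, hq, hq'⟩ := hT.1.exists_path_of_dist a b
  rw [← hq', (hT.existsUnique_path a b).unique hp hq]

/-- Concatenating two geodesics that overlap in a segment of positive length gives a geodesic. -/
theorem IsTree.dist_add_dist_add_dist (hT : T.IsTree) {a b c e : V} (hbc : b ≠ c)
    (h₁ : T.dist a b + T.dist b c = T.dist a c) (h₂ : T.dist b c + T.dist c e = T.dist b e) :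
    T.dist a e = T.dist a b + T.dist b c + T.dist c e := by
  obtain ⟨p, -, hp⟩ := hT.1.exists_path_of_dist a b
  obtain ⟨q, -, hq⟩ := hT.1.exists_path_of_dist b c
  obtain ⟨r, -, hr⟩ := hT.1.exists_path_of_dist c e
  have hpq := (hT.2.isPath_iff_isChain _).1
    ((p.append q).isPath_of_length_eq_dist (by rw [Walk.length_append]; omega))
  have hqr := (hT.2.isPath_iff_isChain _).1
    ((q.append r).isPath_of_length_eq_dist (by rw [Walk.length_append]; omega))
  rw [Walk.edges_append] at hpq hqr
  have hne : q.edges ≠ [] := fun h => by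
    have hl := q.length_edges
    rw [h, hq] at hl
    exact hbc (hT.1.dist_eq_zero_iff.1 hl.symm)
  have := hpq.append_overlap hqr hne
  rw [← Walk.edges_append, ← Walk.edges_append, ← hT.2.isPath_iff_isChain] at this
  rw [← hT.length_eq_dist this, Walk.length_append, Walk.length_append]
  omega

/-- The path from `a` to `b` either passes through `c` or extends to `c`, so the two distances
differ by one. -/
theorem IsTree.dist_ne_of_adj_right (hT : T.IsTree) {a b c : V} (h : T.Adj b c) :
    T.dist a b ≠ T.dist a c := by
  classical
  intro heq
  obtain ⟨p, hp, hp'⟩ := hT.1.exists_path_of_dist a b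
  by_cases hc : c ∈ p.support
  · have h1 := hT.length_eq_dist (hp.takeUntil hc)
    have h2 := hT.length_eq_dist (hp.dropUntil hc)
    have h3 := congrArg Walk.length (p.take_spec hc)
    rw [Walk.length_append] at h3
    have h4 := dist_eq_one_iff_adj.2 h.symm
    omega
  · have := hT.length_eq_dist (hp.concat hc h)
    rw [Walk.length_concat] at this
    omega

theorem IsTree.dist_eq_two (hT : T.IsTree) {a b c : V} (hab : T.Adj a b) (hbc : T.Adj b c)
    (hac : a ≠ c) : T.dist a c = 2 := by
  have h1 := dist_eq_one_iff_adj.2 hab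
  have h2 := dist_eq_one_iff_adj.2 hbc
  have h3 := hT.dist_ne_of_adj_right (a := a) hbc
  have h4 := hT.1.pos_dist_of_ne hac
  have h5 := hT.1.dist_triangle (u := a) (v := b) (w := c)
  omega

/-- A bi-infinite geodesic. -/
def IsLine (T : SimpleGraph V) (v : ℤ → V) : Prop :=
  ∀ i j, T.dist (v i) (v j) = (i - j).natAbs

/-- In a tree local geodesics are geodesics: each new edge is glued along an overlap of one edge. -/
theorem IsTree.isLine_of_adj_of_ne (hT : T.IsTree) {v : ℤ → V} (h₁ : ∀ i, T.Adj (v i) (v (i + 1)))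
    (h₂ : ∀ i, v i ≠ v (i + 2)) : T.IsLine v := by
  have key : ∀ (n : ℕ) (i : ℤ), T.dist (v i) (v (i + n)) = n ∧
      T.dist (v i) (v (i + n + 1)) = n + 1 := by
    intro n i
    induction n with
    | zero => simpa using dist_eq_one_iff_adj.2 (h₁ i)
    | succ n ih =>
      push_cast
      refine ⟨by simpa [add_assoc] using ih.2, ?_⟩
      have e1 := dist_eq_one_iff_adj.2 (h₁ (i + n))
      have e2 := dist_eq_one_iff_adj.2 (h₁ (i + n + 1))
      have e3 := hT.dist_eq_two (h₁ (i + n)) (h₁ (i + n + 1)) (by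
        have := h₂ (i + n)
        rwa [← one_add_one_eq_two, ← add_assoc] at this)
      have := hT.dist_add_dist_add_dist (a := v i) (e := v (i + n + 1 + 1)) (h₁ (i + n)).ne
        (by omega) (by omega)
      rw [← add_assoc, this]
      omega
  intro i j
  rcases le_total i j with h | h
  · obtain ⟨n, rfl⟩ := Int.le.dest h
    rw [(key n i).1]
    omega
  · obtain ⟨n, rfl⟩ := Int.le.dest h
    rw [dist_comm, (key n j).1]
    omega

namespace IsLine

variable {v : ℤ → V}

theorem injective (hv : T.IsLine v) : Function.Injective v := by
  intro i j h
  have := hv i j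
  rw [h, dist_self] at this
  omega

theorem adj (hv : T.IsLine v) (i : ℤ) : T.Adj (v i) (v (i + 1)) := by
  rw [← dist_eq_one_iff_adj, hv]
  omega

theorem neg (hv : T.IsLine v) : T.IsLine fun i => v (-i) := by
  intro i j
  rw [hv]
  omega

/-- The nearest point projection of a vertex to a line. -/
theorem exists_dist_eq (hT : T.IsTree) (hv : T.IsLine v) (w : V) :
    ∃ (k : ℤ) (m : ℕ), (∀ j, T.dist w (v j) = m + (j - k).natAbs) ∧ (m = 0 → w = v k) := by
  have hne : (Set.range fun j => T.dist w (v j)).Nonempty := ⟨_, 0, rfl⟩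
  obtain ⟨k, hk⟩ := Nat.sInf_mem hne
  have hmin : ∀ j, T.dist w (v k) ≤ T.dist w (v j) := fun j => hk.le.trans (Nat.sInf_le ⟨j, rfl⟩)
  -- From a nearest point the first step along the line increases the distance to `w`, and from then
  -- on it keeps growing. Stated for any line, so that it also applies to the reversed one.
  have key : ∀ {u : ℤ → V}, T.IsLine u → ∀ i : ℤ, (∀ j, T.dist w (u i) ≤ T.dist w (u j)) →
      ∀ n : ℕ, T.dist w (u (i + n)) = T.dist w (u i) + n := by
    intro u hu i hi n
    rcases Nat.eq_zero_or_pos n with rfl | hn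
    · simp
    have e1 := dist_eq_one_iff_adj.2 (hu.adj i)
    have e2 := hT.dist_ne_of_adj_right (a := w) (hu.adj i)
    have e3 := hT.1.dist_triangle (u := w) (v := u i) (w := u (i + 1))
    have e4 := hi (i + 1)
    have e5 := hu (i + 1) (i + n)
    have e6 := hu i (i + n)
    have := hT.dist_add_dist_add_dist (a := w) (e := u (i + n)) (hu.adj i).ne (by omega) (by omega)
    omega
  refine ⟨k, T.dist w (v k), fun j => ?_, fun h => hT.1.dist_eq_zero_iff.1 h⟩
  rcases le_total k j with h | h
  · obtain ⟨n, rfl⟩ := Int.le.dest h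
    rw [key hv k hmin]
    omega
  · obtain ⟨n, rfl⟩ := Int.le.dest h
    have := key hv.neg (-(j + n)) (by simpa using fun i => hmin (-i)) n
    simp only [neg_neg, neg_add_rev, neg_add_cancel_right, add_comm j] at this ⊢
    rw [this]
    omega

theorem eq_of_dist (hT : T.IsTree) (hv : T.IsLine v) {w : V} {a b i : ℤ} (hai : a ≤ i) (hib : i ≤ b)
    (h₁ : T.dist w (v a) = (i - a).natAbs) (h₂ : T.dist w (v b) = (b - i).natAbs) : w = v i := by
  obtain ⟨k, m, h, hm⟩ := hv.exists_dist_eq hT w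
  have ha := h a
  have hb := h b
  obtain rfl : k = i := by omega
  exact hm (by omega)

end IsLine

theorem Iso.dist_apply (f : T ≃g T) (a b : V) : T.dist (f a) (f b) = T.dist a b := by
  have key : ∀ (f : T ≃g T) (a b : V), T.Reachable a b → T.dist (f a) (f b) ≤ T.dist a b := by
    intro f a b h
    obtain ⟨p, hp⟩ := h.exists_walk_length_eq_dist
    rw [← hp, ← Walk.length_map f.toHom p]
    exact dist_le _
  by_cases h : T.Reachable a b
  · refine le_antisymm (key f a b h) ?_
    have h' := f.reachable_iff.2 h
    simpa using key f.symm _ _ h'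
  · rw [dist_eq_zero_of_not_reachable h,
      dist_eq_zero_of_not_reachable fun h' => h (f.reachable_iff.1 h')]

/-- A shift along a line has displacement at least the shift, with equality only on the line. -/
theorem IsLine.le_dist_apply (hT : T.IsTree) {v : ℤ → V} (hv : T.IsLine v) {L : ℕ} (hL : 0 < L)
    (f : T ≃g T) (hf : ∀ i, f (v i) = v (i + L)) (w : V) :
    L ≤ T.dist w (f w) ∧ (T.dist w (f w) ≤ L → ∃ i, w = v i) := by
  obtain ⟨k, m, hk, hm⟩ := hv.exists_dist_eq hT w
  have e1 := hk k
  have e2 := hk (k + L)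
  have e3 := hk (k - L)
  have e4 := f.dist_apply w (v (k - L))
  have e5 := f.dist_apply w (v k)
  rw [hf] at e4 e5
  rw [sub_add_cancel, dist_comm] at e4
  rw [dist_comm] at e5
  have e6 := hv k (k + L)
  -- The geodesic from `w` to `f w` runs through the projections `v k` and `v (k + L)`, so the
  -- displacement is `2 * m + L`.
  have := hT.dist_add_dist_add_dist (a := w) (b := v k) (c := v (k + L)) (e := f w)
    (fun h => by have := hv.injective h; omega) (by omega) (by omega)
  exact ⟨by omega, fun h => ⟨k, hm (by omega)⟩⟩

end SimpleGraph

/-! ### The axis of a hyperbolic element of exponent zero -/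

namespace BassSerre

section

variable {A : Type*} [Group A] {C D : Subgroup A} {φ : C ≃* D}

open HNNExtension

theorem dist_smul (g : HNNExtension A C D φ) (v w : Vertex φ) :
    (graph φ).dist (g • v) (g • w) = (graph φ).dist v w :=
  (smulIso φ g).dist_apply v w

theorem vertexDist_nonneg (v : Vertex φ) (x : Tree φ) : 0 ≤ vertexDist v x := by
  cases x with
  | vertex w => exact Nat.cast_nonneg _
  | edge e s =>
    have h1 := s.2.1
    have h2 := s.2.2
    refine le_min ?_ ?_
    · positivity
    · have := sub_pos.2 h2
      positivity

theorem tree_dist_nonneg (x y : Tree φ) : 0 ≤ dist x y := by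
  change 0 ≤ treeDist x y
  cases x with
  | vertex v => exact vertexDist_nonneg v y
  | edge e s =>
    cases y with
    | vertex w => exact vertexDist_nonneg w (.edge e s)
    | edge e' s' =>
      have h1 := s.2.1
      have h2 := sub_pos.2 s.2.2
      rw [treeDist]
      split_ifs
      · exact abs_nonneg _
      · have h3 := vertexDist_nonneg e.origin (.edge e' s')
        have h4 := vertexDist_nonneg e.terminus (.edge e' s')
        exact le_min (by linarith) (by linarith)

theorem translationLength_le (g : HNNExtension A C D φ) (x : Tree φ) :
    GTree.translationLength (Tree φ) g ≤ dist x (g • x) :=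
  ciInf_le ⟨0, by rintro _ ⟨y, rfl⟩; exact tree_dist_nonneg _ _⟩ x

theorem smul_vertex (g : HNNExtension A C D φ) (v : Vertex φ) :
    g • (Tree.vertex v) = Tree.vertex (g • v) := rfl

theorem smul_edge (g : HNNExtension A C D φ) (e : Edge φ) (s : Set.Ioo (0 : ℝ) 1) :
    g • (Tree.edge e s) = Tree.edge (g • e) s := rfl

theorem dist_vertex (v w : Vertex φ) :
    dist (Tree.vertex v) (Tree.vertex w) = ((graph φ).dist v w : ℝ) := rfl

theorem smul_ne_of_isHyperbolic {g : HNNExtension A C D φ} (hg : GTree.IsHyperbolic (Tree φ) g)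
    (v : Vertex φ) : g • v ≠ v := by
  intro h
  have := hg.trans_le (translationLength_le g (Tree.vertex v))
  rw [smul_vertex, h, dist_vertex, SimpleGraph.dist_self] at this
  simp at this

theorem height_of_adj {v w : Vertex φ} (h : (graph φ).Adj v w) :
    height w = height v + 1 ∨ height w = height v - 1 := by
  obtain ⟨e, ⟨rfl, rfl⟩ | ⟨rfl, rfl⟩⟩ := adj_iff.1 h <;> have := height_terminus e <;> omega

/-- A hyperbolic element of `t`-exponent zero shifts a line. -/
theorem exists_line {g : HNNExtension A C D φ} (hg : GTree.IsHyperbolic (Tree φ) g)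
    (hexp : tExponent φ g = 1) :
    ∃ (L : ℕ) (v : ℤ → Vertex φ), 0 < L ∧ (graph φ).IsLine v ∧ ∀ i, g • v i = v (i + L) := by
  have hne : (Set.range fun w : Vertex φ => (graph φ).dist w (g • w)).Nonempty :=
    ⟨_, ((1 : HNNExtension A C D φ) : Vertex φ), rfl⟩
  obtain ⟨w, hw⟩ := Nat.sInf_mem hne
  have hmin : ∀ w', (graph φ).dist w (g • w) ≤ (graph φ).dist w' (g • w') :=
    fun w' => hw.le.trans (Nat.sInf_le ⟨w', rfl⟩)
  obtain ⟨p, hp⟩ := graph_connected.exists_walk_length_eq_dist w (g • w)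
  clear hw
  generalize hL : p.length = L at hp
  rw [← hp] at hmin
  set u : ℕ → Vertex φ := p.getVert with hu
  have hu0 : u 0 = w := p.getVert_zero
  have huL : u L = g • w := by rw [hu, ← hL]; exact p.getVert_length
  have hadj : ∀ r < L, (graph φ).Adj (u r) (u (r + 1)) := fun r hr =>
    p.adj_getVert_succ (hL ▸ hr)
  have hL2 : 2 ≤ L := by
    have h0 : L ≠ 0 := by
      rintro rfl
      exact smul_ne_of_isHyperbolic hg w (huL.symm.trans hu0)
    -- `g` preserves heights, while adjacent vertices have different heights.
    have h1 : L ≠ 1 := by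
      rintro rfl
      have := height_of_adj (hadj 0 one_pos)
      rw [zero_add, huL, hu0, height_smul, hexp] at this
      simp at this
      omega
    omega
  have hle : ∀ k r, r + k ≤ L → (graph φ).dist (u r) (u (r + k)) ≤ k := by
    intro k r
    induction k with
    | zero => simp
    | succ k ih =>
      intro hk
      have h1 := SimpleGraph.dist_eq_one_iff_adj.2 (hadj (r + k) (by omega))
      have h2 := graph_connected.dist_triangle (u := u r) (v := u (r + k)) (w := u (r + k + 1))
      have := ih (by omega)
      rw [← add_assoc]
      omega
  have hlt : ∀ r, r + 2 ≤ L → u r ≠ u (r + 2) := by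
    intro r hr heq
    have h1 := hle r 0 (by omega)
    have h2 := hle (L - (r + 2)) (r + 2) (by omega)
    rw [zero_add, hu0] at h1
    rw [← heq, show r + 2 + (L - (r + 2)) = L by omega, huL] at h2
    have := graph_connected.dist_triangle (u := w) (v := u r) (w := g • w)
    omega
  -- A backtrack where two translates of the path meet would give `u 1` displacement at most `L -
  -- 2`, against minimality.
  have hturn : u (L - 1) ≠ g • u 1 := by
    intro heq
    have h1 := hmin (u 1)
    have h2 := hle (L - 2) 1 (by omega)
    rw [← heq] at h1
    rw [show 1 + (L - 2) = L - 1 by omega] at h2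
    omega
  have hL0 : (0 : ℤ) < L := by omega
  -- The translates of the path by powers of `g`, placed end to end.
  set v : ℤ → Vertex φ := fun i => g ^ (i / (L : ℤ)) • u (i % (L : ℤ)).toNat with hv
  have hvq : ∀ (q : ℤ) (r : ℕ), r ≤ L → v (q * L + r) = g ^ q • u r := by
    intro q r hr
    rcases hr.lt_or_eq with h | rfl
    · rw [hv]
      simp only
      rw [Int.add_comm, Int.add_mul_ediv_right _ _ hL0.ne', Int.add_mul_emod_self_right,
        Int.ediv_eq_zero_of_lt (by omega) (by omega), Int.emod_eq_of_lt (by omega) (by omega),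
        zero_add, Int.toNat_natCast]
    · rw [hv]
      simp only
      rw [← add_one_mul, Int.mul_ediv_cancel _ hL0.ne', Int.mul_emod_left, huL, zpow_add_one,
        mul_smul]
      simp [hu0]
  have hex : ∀ i : ℤ, ∃ (q : ℤ) (r : ℕ), r < L ∧ i = q * L + r := by
    intro i
    have h1 := Int.emod_nonneg i hL0.ne'
    have h2 := Int.emod_lt_of_pos i hL0
    refine ⟨i / L, (i % L).toNat, by omega, ?_⟩
    rw [Int.toNat_of_nonneg h1]
    exact (Int.ediv_mul_add_emod i L).symm
  refine ⟨L, v, by omega, graph_isTree.isLine_of_adj_of_ne ?_ ?_, ?_⟩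
  · intro i
    obtain ⟨q, r, hr, rfl⟩ := hex i
    rw [add_assoc, ← Nat.cast_succ, hvq _ _ hr.le, hvq _ _ hr]
    exact adj_smul _ (hadj r hr)
  · intro i
    obtain ⟨q, r, hr, rfl⟩ := hex i
    by_cases h : r + 2 ≤ L
    · have : (q * L + r + 2 : ℤ) = q * L + (r + 2 : ℕ) := by push_cast; ring
      rw [this, hvq _ _ hr.le, hvq _ _ h]
      exact fun h' => hlt r h (smul_left_cancel _ h')
    · obtain rfl : r = L - 1 := by omega
      have : (q * L + (L - 1 : ℕ) + 2 : ℤ) = (q + 1) * L + (1 : ℕ) := by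
        push_cast [Nat.cast_sub (show 1 ≤ L by omega)]; ring
      rw [this, hvq _ _ hr.le, hvq _ _ (by omega), zpow_add_one, mul_smul]
      exact fun h' => hturn (smul_left_cancel _ h')
  · intro i
    obtain ⟨q, r, hr, rfl⟩ := hex i
    have : (q * L + r + L : ℤ) = (q + 1) * L + r := by ring
    rw [this, hvq _ _ hr.le, hvq _ _ hr.le, ← mul_smul, add_comm, zpow_one_add]

end

end BassSerre

/-! ### Rigidity of the axis from central edge groups -/

namespace BassSerre

section

variable {A : Type*} [Group A] {C D : Subgroup A} {φ : C ≃* D}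

open HNNExtension

/-- `u` fixes the vertex `v`, and acts there as (a conjugate of) `a`. -/
def HasLabel (u : HNNExtension A C D φ) (v : Vertex φ) (a : A) : Prop :=
  ∃ q : HNNExtension A C D φ, (q : Vertex φ) = v ∧ u = q * of a * q⁻¹

theorem HasLabel.smul_eq {u : HNNExtension A C D φ} {v : Vertex φ} {a : A} (h : HasLabel u v a) :
    u • v = v := by
  obtain ⟨q, rfl, rfl⟩ := h
  rw [MulAction.Quotient.smul_coe, eq_comm, mk_eq_iff]
  exact ⟨a, by simp⟩

theorem exists_hasLabel {u : HNNExtension A C D φ} {v : Vertex φ} (h : u • v = v) :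
    ∃ a, HasLabel u v a := by
  induction v using QuotientGroup.induction_on with
  | H q =>
    rw [MulAction.Quotient.smul_coe, eq_comm, mk_eq_iff] at h
    obtain ⟨a, ha⟩ := h
    exact ⟨a, q, rfl, by rw [← ha]; simp⟩

/-- A label is determined only up to conjugacy in `A`; a central one does not depend on the coset
representative. -/
theorem HasLabel.eq_conj {u q : HNNExtension A C D φ} {a : A} (ha : a ∈ Subgroup.center A)
    (h : HasLabel u q a) : u = q * of a * q⁻¹ := by
  obtain ⟨q', hq, rfl⟩ := h
  obtain ⟨b, rfl⟩ := mk_eq_iff.1 hq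
  have hcomm : (of b * of a * (of b)⁻¹ : HNNExtension A C D φ) = of a := by
    rw [mul_inv_eq_iff_eq_mul, ← map_mul, ← map_mul, Subgroup.mem_center_iff.1 ha b]
  conv_lhs => rw [← hcomm]
  group

theorem HasLabel.eq {u : HNNExtension A C D φ} {v : Vertex φ} {a b : A}
    (hb : b ∈ Subgroup.center A) (h : HasLabel u v b) (h' : HasLabel u v a) : a = b := by
  obtain ⟨q, rfl, hq⟩ := h'
  rw [h.eq_conj hb, mul_left_inj, mul_right_inj] at hq
  exact (of_injective φ hq).symm

theorem HasLabel.origin (hC : C ≤ Subgroup.center A) {u : HNNExtension A C D φ} {e : Edge φ}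
    {c : C} (h : HasLabel u e.terminus c) : HasLabel u e.origin (φ c) := by
  induction e using QuotientGroup.induction_on with
  | H x =>
    refine ⟨x * t⁻¹, rfl, ?_⟩
    rw [HasLabel.eq_conj (hC c.2) h, equiv_eq_conj]
    group

theorem HasLabel.terminus (hD : D ≤ Subgroup.center A) {u : HNNExtension A C D φ} {e : Edge φ}
    {c : C} (h : HasLabel u e.origin (φ c)) : HasLabel u e.terminus c := by
  induction e using QuotientGroup.induction_on with
  | H x =>
    refine ⟨x, rfl, ?_⟩
    rw [HasLabel.eq_conj (hD (φ c).2) h, equiv_eq_conj]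
    group

/-- By Britton's lemma, the common stabilizer of both ends of an edge is a conjugate of `C`. -/
theorem exists_hasLabel_terminus {u : HNNExtension A C D φ} {e : Edge φ}
    (ho : u • e.origin = e.origin) (ht : u • e.terminus = e.terminus) :
    ∃ c : C, HasLabel u e.terminus c := by
  induction e using QuotientGroup.induction_on with
  | H x =>
    rw [terminus_mk, MulAction.Quotient.smul_coe, eq_comm, mk_eq_iff] at ht
    rw [origin_mk, MulAction.Quotient.smul_coe, eq_comm, mk_eq_iff] at ho
    obtain ⟨a, ha⟩ := ht
    obtain ⟨b, hb⟩ := ho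
    rw [smul_eq_mul] at ha hb
    have h : (t * of a * t⁻¹ : HNNExtension A C D φ) = of b := by
      rw [← mul_assoc, ha] at hb
      have := congrArg (fun z => t * x⁻¹ * z) hb
      simpa [mul_assoc] using this
    exact ⟨⟨a, mem_of_t_mul_of_mul_inv_t h⟩, x, rfl, by rw [← ha]; simp⟩

open Classical in
variable (φ) in
/-- The isomorphism `φ`, extended to all of `A` by a junk value. -/
noncomputable def extend (a : A) : A := if h : a ∈ C then φ ⟨a, h⟩ else 1

theorem extend_coe (c : C) : extend φ (c : A) = φ c := by
  rw [extend, dif_pos c.2]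

/-- A path in the tree starting at a vertex of maximal height. -/
structure IsDescent (f : ℕ → Vertex φ) (d : ℕ → ℕ) : Prop where
  adj : ∀ n, (graph φ).Adj (f n) (f (n + 1))
  height_eq : ∀ n, height (f n) + d n = height (f 0)

theorem IsDescent.exists_edge {f : ℕ → Vertex φ} {d : ℕ → ℕ} (hf : IsDescent f d) (n : ℕ) :
    ∃ e : Edge φ, (e.origin = f n ∧ e.terminus = f (n + 1) ∧ d n = d (n + 1) + 1) ∨
      (e.origin = f (n + 1) ∧ e.terminus = f n ∧ d (n + 1) = d n + 1) := by
  obtain ⟨e, ⟨h1, h2⟩ | ⟨h1, h2⟩⟩ := adj_iff.1 (hf.adj n) <;>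
  · have h3 := height_terminus e
    have h4 := hf.height_eq n
    have h5 := hf.height_eq (n + 1)
    rw [h1, h2] at h3
    refine ⟨e, ?_⟩
    simp only [h1, h2, true_and]
    omega

/-- Each step down applies `φ` to the label and each step up undoes it; the label at depth `d n` is
the `d n`-th iterate, whatever the route. The membership assumption keeps `extend` away from its
junk value. -/
theorem IsDescent.hasLabel (hC : C ≤ Subgroup.center A) (hD : D ≤ Subgroup.center A)
    {f : ℕ → Vertex φ} {d : ℕ → ℕ} (hf : IsDescent f d) {u : HNNExtension A C D φ} {a : A} {K : ℕ}
    (hdK : ∀ n, d n ≤ K) (ha : ∀ k < K, (extend φ)^[k] a ∈ C) (h0 : HasLabel u (f 0) a) (n : ℕ) :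
    HasLabel u (f n) ((extend φ)^[d n] a) := by
  induction n with
  | zero =>
    have := hf.height_eq 0
    obtain h : d 0 = 0 := by omega
    rwa [h]
  | succ n ih =>
    obtain ⟨e, ⟨h1, h2, h3⟩ | ⟨h1, h2, h3⟩⟩ := hf.exists_edge n
    · rw [h3, Function.iterate_succ_apply', ← h1] at ih
      have hmem := ha (d (n + 1)) (by have := hdK n; omega)
      rw [← h2]
      exact HasLabel.terminus hD (c := ⟨_, hmem⟩) (by rwa [← extend_coe])
    · have hmem := ha (d n) (by have := hdK (n + 1); omega)
      rw [h3, Function.iterate_succ_apply', ← h1]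
      rw [← h2] at ih
      have := HasLabel.origin hC (c := ⟨_, hmem⟩) ih
      rwa [← extend_coe] at this

/-- Conversely, fixing a path that descends to depth `d n` forces the iterates of the label before
that depth to lie in `C`. -/
theorem IsDescent.mem_of_smul_eq (hC : C ≤ Subgroup.center A) (hD : D ≤ Subgroup.center A)
    {f : ℕ → Vertex φ} {d : ℕ → ℕ} (hf : IsDescent f d) {u : HNNExtension A C D φ} {a : A}
    (h0 : HasLabel u (f 0) a) {N : ℕ} (hu : ∀ n ≤ N, u • f n = f n) {n : ℕ} (hn : n ≤ N) :
    HasLabel u (f n) ((extend φ)^[d n] a) ∧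
      ∃ K, d n ≤ K ∧ ∀ k < K, (extend φ)^[k] a ∈ C := by
  induction n with
  | zero =>
    have := hf.height_eq 0
    obtain h : d 0 = 0 := by omega
    exact ⟨by rwa [h], 0, h.le, by simp⟩
  | succ n ih =>
    obtain ⟨ih, K, hK, hmem⟩ := ih (by omega)
    obtain ⟨e, ⟨h1, h2, h3⟩ | ⟨h1, h2, h3⟩⟩ := hf.exists_edge n
    · refine ⟨?_, K, by omega, hmem⟩
      rw [h3, Function.iterate_succ_apply', ← h1] at ih
      have hmem := hmem (d (n + 1)) (by omega)
      rw [← h2]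
      exact HasLabel.terminus hD (c := ⟨_, hmem⟩) (by rwa [← extend_coe])
    · obtain ⟨c, hc⟩ := exists_hasLabel_terminus (u := u) (e := e) (by rw [h1]; exact hu _ hn)
        (by rw [h2]; exact hu _ (by omega))
      rw [← h2] at ih
      have heq := hc.eq (hC c.2) ih
      refine ⟨?_, max K (d n + 1), by omega, fun k hk => ?_⟩
      · rw [h3, Function.iterate_succ_apply', ← h1, heq, extend_coe]
        exact hc.origin hC
      · rcases lt_or_ge k K with h | h
        · exact hmem k h
        · obtain rfl : k = d n := by omega
          rw [heq]
          exact c.2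

/-- An element that fixes a segment of a line fixes the whole line if the segment contains vertices
of maximal and of minimal height. -/
theorem smul_eq_of_smul_eq_on (hC : C ≤ Subgroup.center A) (hD : D ≤ Subgroup.center A)
    {v : ℤ → Vertex φ} (hv : ∀ i, (graph φ).Adj (v i) (v (i + 1))) {u : HNNExtension A C D φ}
    {a b i₀ j₀ : ℤ} (h : ∀ i, a ≤ i → i ≤ b → u • v i = v i) (hi₀ : a ≤ i₀ ∧ i₀ ≤ b)
    (hj₀ : a ≤ j₀ ∧ j₀ ≤ b) (hmax : ∀ i, height (v i) ≤ height (v i₀))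
    (hmin : ∀ i, height (v j₀) ≤ height (v i)) (i : ℤ) : u • v i = v i := by
  set d : ℤ → ℕ := fun i => (height (v i₀) - height (v i)).toNat with hd
  have hdv : ∀ i, height (v i) + d i = height (v i₀) := fun i => by
    have := hmax i
    simp only [hd]
    omega
  have hright : IsDescent (fun n : ℕ => v (i₀ + n)) fun n => d (i₀ + n) :=
    ⟨fun n => by simpa [add_assoc] using hv (i₀ + n), fun n => by simpa using hdv (i₀ + n)⟩
  have hleft : IsDescent (fun n : ℕ => v (i₀ - n)) fun n => d (i₀ - n) := by
    refine ⟨fun n => ?_, fun n => by simpa using hdv (i₀ - n)⟩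
    have := (hv (i₀ - n - 1)).symm
    rw [sub_add_cancel] at this
    simpa [sub_sub] using this
  obtain ⟨c, hc⟩ := exists_hasLabel (h i₀ hi₀.1 hi₀.2)
  have hc1 : HasLabel u (v (i₀ + (0 : ℕ))) c := by simpa using hc
  have hc2 : HasLabel u (v (i₀ - (0 : ℕ))) c := by simpa using hc
  obtain ⟨K, hK, hmem⟩ : ∃ K, d j₀ ≤ K ∧ ∀ k < K, (extend φ)^[k] c ∈ C := by
    rcases le_total i₀ j₀ with hle | hle
    · obtain ⟨n, rfl⟩ := Int.le.dest hle
      exact (hright.mem_of_smul_eq hC hD hc1 (N := n)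
        (fun m hm => h _ (by omega) (by omega)) le_rfl).2
    · obtain ⟨n, rfl⟩ := Int.le.dest hle
      have := (hleft.mem_of_smul_eq hC hD hc2 (N := n)
        (fun m hm => h _ (by omega) (by omega)) le_rfl).2
      simpa using this
  have hdK : ∀ i, d i ≤ K := fun i => by
    have h1 := hdv i
    have h2 := hdv j₀
    have h3 := hmin i
    omega
  rcases le_total i₀ i with hle | hle
  · obtain ⟨n, rfl⟩ := Int.le.dest hle
    exact (hright.hasLabel hC hD (fun n => hdK _) hmem hc1 n).smul_eq
  · obtain ⟨n, rfl⟩ := Int.le.dest hle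
    have := (hleft.hasLabel hC hD (fun n => hdK _) hmem hc2 n).smul_eq
    simpa using this

end

end BassSerre

/-! ### Counting windows and reversing a periodic line -/

/-- If two injective self-maps of a finite set both realize the involution `ι` on the values of `f`,
one of them with at most one exception, then there is no exception. -/
theorem Finset.apply_eq_of_forall_ne {α β : Type*} (S : Finset α) (f : α → β) (ι : β → β)
    {π ρ : α → α} (hπ : Set.MapsTo π S S) (hπ' : Set.InjOn π S) (hρ : Set.MapsTo ρ S S)
    (hρ' : Set.InjOn ρ S) (hfπ : ∀ s ∈ S, f (π s) = ι (f s)) {s₀ : α} (hs₀ : s₀ ∈ S)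
    (hfρ : ∀ s ∈ S, s ≠ s₀ → f (ρ s) = ι (f s)) : f (ρ s₀) = ι (f s₀) := by
  classical
  -- An injective self-map of `S` permutes it, so `f ∘ τ` and `f` have the same multiset of values.
  have key : ∀ τ : α → α, Set.MapsTo τ S S → Set.InjOn τ S →
      S.val.map (fun s => f (τ s)) = S.val.map f := by
    intro τ h1 h2
    have himg : S.image τ = S :=
      Finset.eq_of_subset_of_card_le (Finset.image_subset_iff.2 h1)
        (Finset.card_image_of_injOn h2).ge
    conv_rhs => rw [← himg, Finset.image_val_of_injOn h2, Multiset.map_map]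
    rfl
  have h1 := key π hπ hπ'
  rw [← key ρ hρ hρ', Multiset.map_congr rfl hfπ] at h1
  have hS : S.val = s₀ ::ₘ (S.erase s₀).val := by
    rw [Finset.erase_val, Multiset.cons_erase hs₀]
  rw [hS, Multiset.map_cons, Multiset.map_cons,
    Multiset.map_congr rfl fun s hs => (hfρ s (Finset.mem_of_mem_erase hs)
      (Finset.ne_of_mem_erase hs)), Multiset.cons_inj_left] at h1
  exact h1.symm

namespace Periodic

variable {G V : Type*} [Group G] [MulAction G V] {v : ℤ → V} {g : G} {L : ℕ} {P : ℤ → ℤ}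

theorem exists_add_mul_mem (hL : 0 < L) (x i : ℤ) : ∃ n : ℤ, x ≤ i + n * L ∧ i + n * L < x + L := by
  have hL' : (0 : ℤ) < L := by omega
  refine ⟨-((i - x) / L), ?_⟩
  have h1 := Int.emod_nonneg (i - x) hL'.ne'
  have h2 := Int.emod_lt_of_pos (i - x) hL'
  have h3 := Int.ediv_mul_add_emod (i - x) L
  rw [neg_mul]
  omega

theorem add_mul (hP : ∀ i, P (i + L) = P i) (n i : ℤ) : P (i + n * L) = P i := by
  have := (Function.Periodic.int_mul (f := P) (c := L) hP n) i
  simpa using this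

theorem exists_min (hL : 0 < L) (hP : ∀ i, P (i + L) = P i) : ∃ i, ∀ j, P i ≤ P j := by
  obtain ⟨i, -, hi⟩ := (Finset.Ico (0 : ℤ) L).exists_min_image P ⟨0, by simp [hL]⟩
  refine ⟨i, fun j => ?_⟩
  obtain ⟨n, hn⟩ := exists_add_mul_mem hL 0 j
  rw [← add_mul hP n j]
  exact hi _ (Finset.mem_Ico.2 (by simpa using hn))

theorem zpow_smul (hg : ∀ i, g • v i = v (i + L)) (n i : ℤ) : g ^ n • v i = v (i + n * L) := by
  induction n with
  | zero => simp
  | succ n ih => rw [add_comm, zpow_one_add, mul_smul, ih, hg]; congr 1; ring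
  | pred n ih =>
    rw [sub_eq_add_neg, add_comm, zpow_add, mul_smul, ih, zpow_neg_one, inv_smul_eq_iff, hg]
    congr 1; ring

/-- Periodicity extends the relation to all integers; applying the reflection twice gives `2 * c =
0`. -/
theorem reflect_eq (hL : 0 < L) (hP : ∀ i, P (i + L) = P i) {x R c : ℤ}
    (h : ∀ i, x ≤ i → i ≤ x + L → P (R - i) = P i + c) (i : ℤ) : P (R - i) = P i := by
  have key : ∀ i, P (R - i) = P i + c := by
    intro i
    obtain ⟨n, h1, h2⟩ := exists_add_mul_mem hL x i
    have := h _ h1 h2.le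
    rw [add_mul hP] at this
    rw [← this, ← add_mul hP (-n)]
    congr 1; ring
  have h1 := key i
  have h2 := key (R - i)
  rw [sub_sub_cancel] at h2
  omega

variable (P) in
/-- `next` sends every integer to the first global minimum of `P` after it. -/
structure IsNextMin (next : ℤ → ℤ) : Prop where
  le : ∀ i j, P (next i) ≤ P j
  lt : ∀ i, i < next i
  next_le : ∀ i z, (∀ j, P z ≤ P j) → i < z → next i ≤ z

theorem exists_isNextMin (hL : 0 < L) (hP : ∀ i, P (i + L) = P i) : ∃ next, IsNextMin P next := by
  obtain ⟨m, hm⟩ := exists_min hL hP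
  have : ∀ i, ∃ z, ((∀ j, P z ≤ P j) ∧ i < z) ∧ ∀ z', ((∀ j, P z' ≤ P j) ∧ i < z') → z ≤ z' := by
    intro i
    refine Int.exists_least_of_bdd ⟨i, fun z hz => hz.2.le⟩ ?_
    obtain ⟨n, hn, -⟩ := exists_add_mul_mem hL (i + 1) m
    exact ⟨m + n * L, fun j => by rw [add_mul hP]; exact hm j, by omega⟩
  choose next h1 h2 using this
  exact ⟨next, fun i => (h1 i).1, fun i => (h1 i).2, fun i z hz hi => h2 i z ⟨hz, hi⟩⟩

namespace IsNextMin

variable {next : ℤ → ℤ}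

theorem add_mul (h : IsNextMin P next) (hP : ∀ i, P (i + L) = P i) (n i : ℤ) :
    next (i + n * L) = next i + n * L := by
  have key : ∀ n i : ℤ, next (i + n * L) ≤ next i + n * L := fun n i =>
    h.next_le _ _ (fun j => by rw [Periodic.add_mul hP]; exact h.le i j) (by have := h.lt i; omega)
  refine le_antisymm (key n i) ?_
  have := key (-n) (i + n * L)
  rw [show i + n * L + -n * L = i by ring, neg_mul] at this
  omega

/-- A reflection preserving `P` takes the window from `s` to `next s` to the window from `R - next
s` to `R - s`. -/
theorem reflect (h : IsNextMin P next) {R s : ℤ} (hR : ∀ i, P (R - i) = P i)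
    (hs : ∀ j, P s ≤ P j) : next (R - next s) = R - s := by
  refine le_antisymm (h.next_le _ _ (fun j => by rw [hR]; exact hs j) (by have := h.lt s; omega)) ?_
  by_contra! hlt
  have h1 := h.next_le s (R - next (R - next s)) (fun j => by rw [hR]; exact h.le _ j) (by omega)
  have h2 := h.lt (R - next s)
  omega

end IsNextMin

variable (G) in
/-- The orbit of the pair of points of the line `v` over two consecutive minima. -/
def windowType (v : ℤ → V) (next : ℤ → ℤ) (s : ℤ) : MulAction.orbitRel.Quotient G (V × V) :=
  Quotient.mk _ (v s, v (next s))

variable (G V) in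
/-- Exchanging the coordinates in an orbit of pairs. -/
def swapOrbit : MulAction.orbitRel.Quotient G (V × V) → MulAction.orbitRel.Quotient G (V × V) :=
  Quotient.map Prod.swap (by
    rintro _ b ⟨h, rfl⟩
    exact ⟨h, rfl⟩)

variable {next : ℤ → ℤ}

theorem windowType_eq_swapOrbit_iff {s t : ℤ} :
    windowType G v next t = swapOrbit G V (windowType G v next s) ↔
      ∃ h : G, h • v (next s) = v t ∧ h • v s = v (next t) := by
  rw [windowType, windowType, swapOrbit, Quotient.map_mk, Quotient.eq, MulAction.orbitRel_apply,
    MulAction.mem_orbit_iff]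
  simp [Prod.ext_iff]

theorem windowType_add_mul (hg : ∀ i, g • v i = v (i + L)) (hP : ∀ i, P (i + L) = P i)
    (hnext : IsNextMin P next) (n s : ℤ) :
    windowType G v next (s + n * L) = windowType G v next s := by
  rw [windowType, windowType, Quotient.eq, MulAction.orbitRel_apply, MulAction.mem_orbit_iff]
  refine ⟨g ^ n, ?_⟩
  rw [hnext.add_mul hP, ← zpow_smul hg, ← zpow_smul hg]
  rfl

theorem windowType_reflect {h : G} {x R s : ℤ} (hnext : IsNextMin P next)
    (hR : ∀ i, P (R - i) = P i) (hh : ∀ k : ℤ, x ≤ k → k ≤ x + L → h • v k = v (R - k))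
    (hs : ∀ j, P s ≤ P j) (hxs : x ≤ s) (hsx : next s ≤ x + L) :
    windowType G v next (R - next s) = swapOrbit G V (windowType G v next s) := by
  have := hnext.lt s
  refine windowType_eq_swapOrbit_iff.2 ⟨h, hh _ (by omega) hsx, ?_⟩
  rw [hnext.reflect hR hs]
  exact hh _ hxs (by omega)

/-- Suppose that all segments of length `L` of an `L`-periodic line can be reversed along the line.
Then the whole line can be reversed. -/
theorem exists_reversal (hL : 0 < L) (hg : ∀ i, g • v i = v (i + L)) (hP : ∀ i, P (i + L) = P i)
    (hheight : ∀ h : G, ∃ c, ∀ i j, h • v i = v j → P j = P i + c)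
    (hfix : ∀ (u : G) (a b i₀ j₀ : ℤ), (∀ i, a ≤ i → i ≤ b → u • v i = v i) →
      (a ≤ i₀ ∧ i₀ ≤ b) → (a ≤ j₀ ∧ j₀ ≤ b) → (∀ i, P i ≤ P i₀) → (∀ i, P j₀ ≤ P i) →
      ∀ i, u • v i = v i)
    (hgeo : ∀ (h : G) (a b R : ℤ), h • v a = v (R - a) → h • v b = v (R - b) →
      ∀ i, a ≤ i → i ≤ b → h • v i = v (R - i))
    (hrev : ∀ x : ℤ, ∃ (h : G) (R : ℤ), ∀ k : ℤ, x ≤ k → k ≤ x + L → h • v k = v (R - k)) :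
    ∃ (h : G) (R : ℤ), ∀ k, h • v k = v (R - k) := by
  have hrev' : ∀ x : ℤ, ∃ (h : G) (R : ℤ), (∀ k : ℤ, x ≤ k → k ≤ x + L → h • v k = v (R - k)) ∧
      ∀ i, P (R - i) = P i := by
    intro x
    obtain ⟨h, R, hR⟩ := hrev x
    obtain ⟨c, hc⟩ := hheight h
    exact ⟨h, R, hR, reflect_eq hL hP fun i h1 h2 => hc _ _ (hR i h1 h2)⟩
  obtain ⟨next, hnext⟩ := exists_isNextMin hL hP
  obtain ⟨y, hy⟩ := exists_min hL hP
  obtain ⟨x, hx⟩ := exists_min (P := fun i => -P i) hL (by simpa using hP)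
  -- `y` is a minimum, so no window straddles the ends of `[y, y + L]`; `x` is a maximum, as
  -- rigidity will require.
  obtain ⟨q, R', hq, hR'⟩ := hrev' y
  obtain ⟨p, R, hp, hR⟩ := hrev' x
  -- the last minimum before `x + L`
  obtain ⟨s₀, ⟨hs₀, hs₀x⟩, hs₀'⟩ := Int.exists_greatest_of_bdd
    (P := fun z => (∀ j, P z ≤ P j) ∧ z < x + L) ⟨x + L, fun z hz => hz.2.le⟩ (by
      obtain ⟨n, -, hn⟩ := exists_add_mul_mem hL x y
      exact ⟨y + n * L, fun j => by rw [add_mul hP]; exact hy j, hn⟩)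
  have hxs₀ : x ≤ s₀ := by
    obtain ⟨n, hn, hn'⟩ := exists_add_mul_mem hL x y
    have := hs₀' _ ⟨fun j => by rw [add_mul hP]; exact hy j, hn'⟩
    omega
  have hnext₀ : x + L ≤ next s₀ := by
    by_contra! h
    have := hs₀' _ ⟨hnext.le s₀, h⟩
    have := hnext.lt s₀
    omega
  have hL' : (0 : ℤ) < L := by omega
  have hmin : ∀ {s}, (∀ j, P s ≤ P j) → ∀ n : ℤ, ∀ j, P (s + n * L) ≤ P j := fun hs n j => by
    rw [add_mul hP]; exact hs j
  have hmod : ∀ i : ℤ, ∃ n : ℤ, i % L = i + n * L := fun i =>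
    ⟨-(i / L), by have := Int.ediv_mul_add_emod i L; rw [neg_mul]; omega⟩
  classical
  -- The starting points of windows, one for each class modulo `L`.
  set S : Finset ℤ := {s ∈ Finset.Ico (0 : ℤ) L | ∀ j, P s ≤ P j} with hS
  have hmemS : ∀ i, (∀ j, P i ≤ P j) → i % (L : ℤ) ∈ S := by
    intro i hi
    rw [hS, Finset.mem_filter, Finset.mem_Ico]
    obtain ⟨n, hn⟩ := hmod i
    exact ⟨⟨Int.emod_nonneg _ hL'.ne', Int.emod_lt_of_pos _ hL'⟩, by rw [hn]; exact hmin hi n⟩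
  have hSmin : ∀ s ∈ S, ∀ j, P s ≤ P j := fun s hs => (Finset.mem_filter.1 hs).2
  have hmaps : ∀ r : ℤ, (∀ i, P (r - i) = P i) →
      Set.MapsTo (fun s => (r - next s) % (L : ℤ)) S S := fun r hr s hs =>
    hmemS _ fun j => by rw [hr]; exact hnext.le s j
  have hinj : ∀ r : ℤ, (∀ i, P (r - i) = P i) →
      Set.InjOn (fun s => (r - next s) % (L : ℤ)) S := by
    intro r hr s hs t ht hst
    simp only at hst
    obtain ⟨n, hn⟩ := hmod (r - next s)
    obtain ⟨m, hm⟩ := hmod (r - next t)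
    rw [hn, hm] at hst
    have h1 : next s = next (t + (n - m) * L) := by
      rw [hnext.add_mul hP]; linear_combination -hst
    have h2 := hnext.reflect hr (hSmin s hs)
    rw [h1, hnext.reflect hr (hmin (hSmin t ht) _)] at h2
    obtain ⟨h3, h4⟩ := Finset.mem_Ico.1 (Finset.mem_filter.1 hs).1
    obtain ⟨h5, h6⟩ := Finset.mem_Ico.1 (Finset.mem_filter.1 ht).1
    have h7 : s = t + (n - m) * L := by linear_combination h2
    rw [← Int.emod_eq_of_lt h3 h4, ← Int.emod_eq_of_lt h5 h6, h7, Int.add_mul_emod_self_right]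
  have htype : ∀ i : ℤ, windowType G v next (i % L) = windowType G v next i := fun i => by
    obtain ⟨n, hn⟩ := hmod i
    rw [hn, windowType_add_mul hg hP hnext]
  have hshift : ∀ r s n : ℤ, windowType G v next (r - next (s + n * L)) =
      windowType G v next (r - next s) := fun r s n => by
    rw [hnext.add_mul hP, ← windowType_add_mul hg hP hnext n]
    congr 1; ring
  -- `q` gives the swap for all windows, `p` for all but the one starting at `s₀`; both reflections
  -- permute the windows modulo `L`.
  have hcount := S.apply_eq_of_forall_ne (windowType G v next) (swapOrbit G V)
    (π := fun s => (R' - next s) % (L : ℤ)) (ρ := fun s => (R - next s) % (L : ℤ))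
    (hmaps R' hR') (hinj R' hR') (hmaps R hR) (hinj R hR) (fun s hs => ?_) (hmemS s₀ hs₀)
    (fun s hs hne => ?_)
  rotate_left
  · obtain ⟨n, h1, h2⟩ := exists_add_mul_mem hL y s
    rw [htype, ← hshift _ _ n, ← windowType_add_mul hg hP hnext n s]
    refine windowType_reflect hnext hR' hq (hmin (hSmin s hs) n) h1 ?_
    exact hnext.next_le _ _ (by simpa using hmin hy 1) h2
  · obtain ⟨n, h1, h2⟩ := exists_add_mul_mem hL x s
    rw [htype, ← hshift _ _ n, ← windowType_add_mul hg hP hnext n s]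
    refine windowType_reflect hnext hR hp (hmin (hSmin s hs) n) h1 ?_
    have h3 := hs₀' _ ⟨hmin (hSmin s hs) n, h2⟩
    have h4 : s + n * L ≠ s₀ := by
      rintro rfl
      obtain ⟨h5, h6⟩ := Finset.mem_Ico.1 (Finset.mem_filter.1 hs).1
      rw [Int.add_mul_emod_self_right, Int.emod_eq_of_lt h5 h6] at hne
      exact hne rfl
    have := hnext.next_le (s + n * L) s₀ hs₀ (by omega)
    omega
  obtain ⟨n, hn⟩ := hmod s₀
  simp only [htype] at hcount
  rw [hn, hshift, windowType_eq_swapOrbit_iff] at hcount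
  obtain ⟨h, hh1, hh2⟩ := hcount
  rw [hnext.reflect hR hs₀] at hh2
  have hh := hgeo h s₀ (next s₀) R hh2 hh1
  have hxL : ∀ i, P i ≤ P (x + L) := fun i => by rw [hP]; have := hx i; omega
  have hxmax : ∀ i, P i ≤ P x := fun i => by have := hx i; omega
  -- `h` and `p` agree on `[s₀, x + L]`, which has a minimum and a maximum as its ends.
  have hph : ∀ i, (p⁻¹ * h) • v i = v i :=
    hfix _ s₀ (x + L) (x + L) s₀ (fun i h1 h2 => by
      rw [mul_smul, inv_smul_eq_iff, hh i h1 (by omega), hp i (by omega) h2])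
      ⟨hs₀x.le, le_rfl⟩ ⟨le_rfl, hs₀x.le⟩ hxL hs₀
  have hp' : ∀ i, x ≤ i → i ≤ next s₀ → p • v i = v (R - i) := by
    intro i h1 h2
    rcases le_total i (x + L) with h3 | h3
    · exact hp i h1 h3
    · rw [← hh i (by omega) h2, eq_comm, ← inv_smul_eq_iff, ← mul_smul]
      exact hph i
  -- For `i` in `[x, next s₀ - L]` both `i` and `i + L` lie where `p` is a reflection. Knowing `p`
  -- only on `[x, x + L]` would leave the single point `i = x`; now the segment also contains the
  -- minimum `next s₀ - L`.
  have hcomm : ∀ i, (p⁻¹ * g * p * g) • v i = v i := by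
    refine hfix _ x (next s₀ - L) x (next s₀ - L) (fun i h1 h2 => ?_) ⟨le_rfl, by omega⟩
      ⟨by omega, le_rfl⟩ hxmax fun j => ?_
    · rw [mul_smul, hg, mul_smul, hp' _ (by omega) (by omega), mul_smul, hg, inv_smul_eq_iff,
        hp' i h1 (by omega)]
      congr 1; ring
    · have := hP (next s₀ - L)
      rw [sub_add_cancel] at this
      rw [← this]
      exact hnext.le s₀ j
  have hstep : ∀ i, p • v (i + L) = g⁻¹ • p • v i := by
    intro i
    have := hcomm i
    rw [mul_smul, hg, mul_smul, mul_smul, inv_smul_eq_iff] at this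
    rw [← this, inv_smul_smul]
  have hiter : ∀ n i : ℤ, g⁻¹ ^ n • p • v i = p • v (i + n * L) :=
    zpow_smul (v := fun i => p • v i) fun i => (hstep i).symm
  refine ⟨p, R, fun k => ?_⟩
  -- On the axis `p` conjugates `g` to its inverse, so its values on one period determine the rest.
  obtain ⟨n, h1, h2⟩ := exists_add_mul_mem hL x k
  have h3 := hiter (-n) (k + n * L)
  rw [hp _ h1 h2.le, inv_zpow, ← zpow_neg, neg_neg, zpow_smul hg] at h3
  rw [show k = k + n * L + -n * L by ring, ← h3]
  congr 1; ring

end Periodic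

/-! ### Real coordinates along the axis in the metric tree -/

namespace BassSerre

section

variable {A : Type*} [Group A] {C D : Subgroup A} {φ : C ≃* D}

open HNNExtension GTree

/-- The point `x` of the tree lies at position `u` on the line through the vertices `v i`. -/
def Coord (v : ℤ → Vertex φ) : Tree φ → ℝ → Prop
  | .vertex w, u => ∃ i : ℤ, w = v i ∧ u = i
  | .edge e s, u => ∃ i j : ℤ, e.origin = v i ∧ e.terminus = v j ∧ (j = i + 1 ∨ j = i - 1) ∧
      u = i + (j - i) * s

variable {v : ℤ → Vertex φ}

theorem coord_vertex (v : ℤ → Vertex φ) (i : ℤ) : Coord v (.vertex (v i)) i := ⟨i, rfl, rfl⟩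

/-- Interior points of edges have non-integral coordinates. -/
theorem Coord.eq_vertex {x : Tree φ} {k : ℤ} (h : Coord v x k) : x = .vertex (v k) := by
  cases x with
  | vertex w =>
    obtain ⟨i, rfl, hi⟩ := h
    rw [Int.cast_inj.1 hi]
  | edge e s =>
    obtain ⟨i, j, -, -, hj, h⟩ := h
    have h1 := s.2.1
    have h2 := s.2.2
    rcases hj with rfl | rfl <;> push_cast at h
    · have h3 : (i : ℝ) < k := by linarith
      have h4 : (k : ℝ) < (i + 1 : ℤ) := by push_cast; linarith
      rw [Int.cast_lt] at h3 h4
      omega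
    · have h3 : (k : ℝ) < i := by linarith
      have h4 : ((i - 1 : ℤ) : ℝ) < k := by push_cast; linarith
      rw [Int.cast_lt] at h3 h4
      omega

theorem Coord.smul_add {g : HNNExtension A C D φ} {n : ℤ} (hg : ∀ i, g • v i = v (i + n))
    {x : Tree φ} {u : ℝ} (h : Coord v x u) : Coord v (g • x) (u + n) := by
  cases x with
  | vertex w =>
    obtain ⟨i, rfl, rfl⟩ := h
    exact ⟨i + n, hg i, by push_cast; rfl⟩
  | edge e s =>
    obtain ⟨i, j, ho, ht, hj, rfl⟩ := h
    refine ⟨i + n, j + n, ?_, ?_, by omega, by push_cast; ring⟩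
    · rw [origin_smul, ho, hg]
    · rw [terminus_smul, ht, hg]

theorem Coord.smul_sub {g : HNNExtension A C D φ} {R : ℤ} (hg : ∀ i, g • v i = v (R - i))
    {x : Tree φ} {u : ℝ} (h : Coord v x u) : Coord v (g • x) (R - u) := by
  cases x with
  | vertex w =>
    obtain ⟨i, rfl, rfl⟩ := h
    exact ⟨R - i, hg i, by push_cast; rfl⟩
  | edge e s =>
    obtain ⟨i, j, ho, ht, hj, rfl⟩ := h
    refine ⟨R - i, R - j, ?_, ?_, by omega, by push_cast; ring⟩
    · rw [origin_smul, ho, hg]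
    · rw [terminus_smul, ht, hg]

theorem line_dist (hv : (graph φ).IsLine v) (i j : ℤ) :
    ((graph φ).dist (v i) (v j) : ℝ) = |(i : ℝ) - j| := by
  rw [hv, Nat.cast_natAbs]
  push_cast
  rfl

theorem vertexDist_edge (w : Vertex φ) (e : Edge φ) (s : Set.Ioo (0 : ℝ) 1) :
    vertexDist w (.edge e s) = min (((graph φ).dist w e.origin : ℝ) + s)
      (((graph φ).dist w e.terminus : ℝ) + (1 - s)) := rfl

theorem Coord.vertexDist_eq (hv : (graph φ).IsLine v) {x : Tree φ} {u : ℝ} (h : Coord v x u)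
    (k : ℤ) : vertexDist (v k) x = |u - k| := by
  cases x with
  | vertex w =>
    obtain ⟨i, rfl, rfl⟩ := h
    rw [abs_sub_comm]
    exact line_dist hv k i
  | edge e s =>
    obtain ⟨i, j, ho, ht, hj, rfl⟩ := h
    have h1 := s.2.1
    have h2 := s.2.2
    rw [vertexDist_edge, ho, ht, line_dist hv, line_dist hv]
    rcases hj with rfl | rfl <;> push_cast
    · rcases le_or_gt k i with hk | hk
      · have hk' : (k : ℝ) ≤ i := Int.cast_le.2 hk
        rw [abs_of_nonpos (by linarith), abs_of_nonpos (by linarith), abs_of_nonneg (by linarith),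
          min_eq_left (by linarith)]
        ring
      · have hk' : ((i + 1 : ℤ) : ℝ) ≤ k := Int.cast_le.2 hk
        push_cast at hk'
        rw [abs_of_nonneg (by linarith), abs_of_nonneg (by linarith), abs_of_nonpos (by linarith),
          min_eq_right (by linarith)]
        ring
    · rcases le_or_gt i k with hk | hk
      · have hk' : (i : ℝ) ≤ k := Int.cast_le.2 hk
        rw [abs_of_nonneg (by linarith), abs_of_nonneg (by linarith), abs_of_nonpos (by linarith),
          min_eq_left (by linarith)]
        ring
      · have hk' : (k : ℝ) ≤ (i - 1 : ℤ) := Int.cast_le.2 (by omega)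
        push_cast at hk'
        rw [abs_of_nonpos (by linarith), abs_of_nonpos (by linarith), abs_of_nonneg (by linarith),
          min_eq_right (by linarith)]
        ring

open Classical in
theorem dist_edge_edge (e e' : Edge φ) (s s' : Set.Ioo (0 : ℝ) 1) :
    dist (Tree.edge e s) (Tree.edge e' s') = if e = e' then |(s : ℝ) - s'| else
      min (s + vertexDist e.origin (.edge e' s'))
        ((1 - s) + vertexDist e.terminus (.edge e' s')) := rfl

/-- A point of a line outside the open unit interval between `i` and `j`. -/
theorem Coord.le_or_le {e : Edge φ} {s : Set.Ioo (0 : ℝ) 1} {w : ℝ} (h : Coord v (.edge e s) w)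
    {e' : Edge φ} (hne : e' ≠ e) {i j : ℤ} (ho : e'.origin = v i) (ht : e'.terminus = v j)
    (hj : j = i + 1 ∨ j = i - 1) : w ≤ min (i : ℝ) j ∨ max (i : ℝ) j ≤ w := by
  obtain ⟨k, l, ho', ht', hl, rfl⟩ := h
  have h1 := s.2.1
  have h2 := s.2.2
  have h3 : ¬ (k = i ∧ l = j) := by
    rintro ⟨rfl, rfl⟩
    exact hne (edge_ext (ho.trans ho'.symm) (ht.trans ht'.symm))
  have h4 : ¬ (k = j ∧ l = i) := by
    rintro ⟨rfl, rfl⟩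
    have h5 := height_terminus e
    have h6 := height_terminus e'
    rw [ho', ht'] at h5
    rw [ho, ht] at h6
    omega
  have h5 : max k l ≤ min i j ∨ max i j ≤ min k l := by omega
  rcases h5 with h5 | h5
  · left
    have h6 : ((max k l : ℤ) : ℝ) ≤ (min i j : ℤ) := Int.cast_le.2 h5
    push_cast at h6
    refine le_trans ?_ h6
    rcases hl with rfl | rfl <;> push_cast
    · exact le_max_of_le_right (by linarith)
    · exact le_max_of_le_left (by linarith)
  · right
    have h6 : ((max i j : ℤ) : ℝ) ≤ (min k l : ℤ) := Int.cast_le.2 h5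
    push_cast at h6
    refine h6.trans ?_
    rcases hl with rfl | rfl <;> push_cast
    · exact min_le_of_left_le (by linarith)
    · exact min_le_of_right_le (by linarith)

theorem Coord.dist_eq (hv : (graph φ).IsLine v) {x y : Tree φ} {u w : ℝ} (hx : Coord v x u)
    (hy : Coord v y w) : dist x y = |u - w| := by
  cases x with
  | vertex z =>
    obtain ⟨i, rfl, rfl⟩ := hx
    rw [abs_sub_comm]
    exact hy.vertexDist_eq hv i
  | edge e s =>
    cases y with
    | vertex z =>
      obtain ⟨i, rfl, rfl⟩ := hy
      exact hx.vertexDist_eq hv i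
    | edge e' s' =>
      rw [dist_edge_edge]
      have h1 := s.2.1
      have h2 := s.2.2
      split_ifs with he
      · subst he
        obtain ⟨i, j, ho, ht, hj, rfl⟩ := hx
        obtain ⟨k, l, ho', ht', hl, rfl⟩ := hy
        obtain rfl := hv.injective (ho.symm.trans ho')
        obtain rfl := hv.injective (ht.symm.trans ht')
        rcases hj with rfl | rfl <;> push_cast
        · congr 1; ring
        · rw [abs_sub_comm]; congr 1; ring
      · obtain ⟨i, j, ho, ht, hj, rfl⟩ := hx
        have hw := hy.le_or_le he ho ht hj
        rw [ho, ht, hy.vertexDist_eq hv, hy.vertexDist_eq hv]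
        rcases hj with rfl | rfl <;> push_cast at hw ⊢
        · rw [min_eq_left (by linarith), max_eq_right (by linarith)] at hw
          rcases hw with hw | hw
          · rw [abs_of_nonpos (by linarith), abs_of_nonpos (by linarith),
              abs_of_nonneg (by linarith), min_eq_left (by linarith)]
            ring
          · rw [abs_of_nonneg (by linarith), abs_of_nonneg (by linarith),
              abs_of_nonpos (by linarith), min_eq_right (by linarith)]
            ring
        · rw [min_eq_right (by linarith), max_eq_left (by linarith)] at hw
          rcases hw with hw | hw
          · rw [abs_of_nonpos (by linarith), abs_of_nonpos (by linarith),
              abs_of_nonneg (by linarith), min_eq_right (by linarith)]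
            ring
          · rw [abs_of_nonneg (by linarith), abs_of_nonneg (by linarith),
              abs_of_nonpos (by linarith), min_eq_left (by linarith)]
            ring

theorem dist_origin_terminus (e : Edge φ) : (graph φ).dist e.origin e.terminus = 1 :=
  SimpleGraph.dist_eq_one_iff_adj.2 (adj_iff.2 ⟨e, .inl ⟨rfl, rfl⟩⟩)

theorem exists_coord_edge (hv : (graph φ).IsLine v) {e : Edge φ} (s : Set.Ioo (0 : ℝ) 1)
    (ho : ∃ i, e.origin = v i) (ht : ∃ j, e.terminus = v j) : ∃ u, Coord v (.edge e s) u := by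
  obtain ⟨i, hi⟩ := ho
  obtain ⟨j, hj⟩ := ht
  have := dist_origin_terminus e
  rw [hi, hj, hv] at this
  exact ⟨_, i, j, hi, hj, by omega, rfl⟩

theorem exists_coord_of_mem_carrier (hv : (graph φ).IsLine v) {a b : ℤ} (hab : a ≤ b)
    {x : Tree φ} (hx : x ∈ (OSeg.mk (Tree.vertex (v a)) (Tree.vertex (v b))).carrier) :
    ∃ u, Coord v x u := by
  cases x with
  | vertex w =>
    obtain ⟨k, m, hk, hm⟩ := hv.exists_dist_eq graph_isTree w
    have h : ((graph φ).dist (v a) w : ℝ) + (graph φ).dist w (v b) = (graph φ).dist (v a) (v b) :=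
      hx
    rw [SimpleGraph.dist_comm, hk, hk, hv] at h
    norm_cast at h
    exact ⟨k, k, hm (by omega), rfl⟩
  | edge e s =>
    have h : vertexDist (v a) (.edge e s) + vertexDist (v b) (.edge e s) =
      ((graph φ).dist (v a) (v b) : ℝ) := hx
    have h1 := s.2.1
    have h2 := s.2.2
    obtain ⟨k, m, hk, hm⟩ := hv.exists_dist_eq graph_isTree e.origin
    obtain ⟨l, n, hl, hn⟩ := hv.exists_dist_eq graph_isTree e.terminus
    have hadj := dist_origin_terminus e
    have h3 := graph_connected.dist_triangle (u := e.origin) (v := e.terminus) (w := v l)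
    have h4 := graph_connected.dist_triangle (u := e.terminus) (v := e.origin) (w := v k)
    rw [SimpleGraph.dist_comm] at hadj
    rw [hadj] at h4
    rw [SimpleGraph.dist_comm] at hadj
    rw [hadj] at h3
    have hka := hk a
    have hkb := hk b
    have hla := hl a
    have hlb := hl b
    have hkl := hk l
    have hlk := hl k
    have hkk := hk k
    have hll := hl l
    have hab' := hv a b
    rw [vertexDist_edge, vertexDist_edge, SimpleGraph.dist_comm (v := e.origin),
      SimpleGraph.dist_comm (v := e.terminus), SimpleGraph.dist_comm (u := v b) (v := e.origin),
      SimpleGraph.dist_comm (u := v b) (v := e.terminus)] at h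
    -- Paths to `v a` and `v b` leaving through the same end of `e` would be too short in total for
    -- the triangle inequality; leaving through different ends, they force both ends of `e` onto the
    -- line.
    suffices m = 0 ∧ n = 0 from
      exists_coord_edge hv s ⟨k, hm this.1⟩ ⟨l, hn this.2⟩
    rcases min_choice (((graph φ).dist e.origin (v a) : ℝ) + s)
        ((graph φ).dist e.terminus (v a) + (1 - s)) with h5 | h5 <;>
      rcases min_choice (((graph φ).dist e.origin (v b) : ℝ) + s)
        ((graph φ).dist e.terminus (v b) + (1 - s)) with h6 | h6 <;>
      rw [h5, h6] at h
    · have : (graph φ).dist e.origin (v a) + (graph φ).dist e.origin (v b) <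
          (graph φ).dist (v a) (v b) := by
        have : ((graph φ).dist e.origin (v a) : ℝ) + (graph φ).dist e.origin (v b) <
          (graph φ).dist (v a) (v b) := by linarith
        exact_mod_cast this
      omega
    · have : (graph φ).dist e.origin (v a) + (graph φ).dist e.terminus (v b) + 1 =
          (graph φ).dist (v a) (v b) := by
        have : ((graph φ).dist e.origin (v a) : ℝ) + (graph φ).dist e.terminus (v b) + 1 =
          (graph φ).dist (v a) (v b) := by linarith
        exact_mod_cast this
      omega
    · have : (graph φ).dist e.terminus (v a) + (graph φ).dist e.origin (v b) + 1 =
          (graph φ).dist (v a) (v b) := by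
        have : ((graph φ).dist e.terminus (v a) : ℝ) + (graph φ).dist e.origin (v b) + 1 =
          (graph φ).dist (v a) (v b) := by linarith
        exact_mod_cast this
      omega
    · have : (graph φ).dist e.terminus (v a) + (graph φ).dist e.terminus (v b) <
          (graph φ).dist (v a) (v b) := by
        have : ((graph φ).dist e.terminus (v a) : ℝ) + (graph φ).dist e.terminus (v b) <
          (graph φ).dist (v a) (v b) := by linarith
        exact_mod_cast this
      omega

section Shift

variable {g : HNNExtension A C D φ} {L : ℕ}

theorem le_dist_smul_vertex (hv : (graph φ).IsLine v) (hL : 0 < L)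
    (hg : ∀ i, g • v i = v (i + L)) (w : Vertex φ) :
    L ≤ (graph φ).dist w (g • w) ∧ ((graph φ).dist w (g • w) ≤ L → ∃ i, w = v i) :=
  hv.le_dist_apply graph_isTree hL (smulIso φ g) hg w

/-- For an interior point, a path of length `L` to its image must leave through one end of the edge
and arrive through the image of the other. Then both ends have displacement at most `L` and lie on
the line. -/
theorem le_dist_smul (hv : (graph φ).IsLine v) (hL : 0 < L) (hg : ∀ i, g • v i = v (i + L))
    (x : Tree φ) : (L : ℝ) ≤ dist x (g • x) ∧ (dist x (g • x) ≤ L → ∃ u, Coord v x u) := by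
  cases x with
  | vertex w =>
    rw [smul_vertex, dist_vertex, Nat.cast_le, Nat.cast_le]
    obtain ⟨h1, h2⟩ := le_dist_smul_vertex hv hL hg w
    refine ⟨h1, fun h => ?_⟩
    obtain ⟨i, hi⟩ := h2 h
    exact ⟨i, i, hi, rfl⟩
  | edge e s =>
    obtain ⟨ho1, ho2⟩ := le_dist_smul_vertex hv hL hg e.origin
    obtain ⟨ht1, ht2⟩ := le_dist_smul_vertex hv hL hg e.terminus
    have hne : e ≠ g • e := by
      intro h
      rw [← origin_smul, ← h, SimpleGraph.dist_self] at ho1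
      omega
    have h1 := s.2.1
    have h2 := s.2.2
    rw [smul_edge, dist_edge_edge, if_neg hne, vertexDist_edge, vertexDist_edge, origin_smul,
      terminus_smul]
    have h3 := dist_origin_terminus e
    have h4 := dist_smul g e.origin e.terminus
    rw [h3] at h4
    have h3' := h3
    have h4' := h4
    rw [SimpleGraph.dist_comm] at h3' h4'
    have t1 := graph_connected.dist_triangle (u := e.origin) (v := e.terminus) (w := g • e.origin)
    have t2 := graph_connected.dist_triangle (u := e.origin) (v := g • e.terminus)
      (w := g • e.origin)
    have t3 := graph_connected.dist_triangle (u := e.terminus) (v := e.origin)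
      (w := g • e.terminus)
    have t4 := graph_connected.dist_triangle (u := e.terminus) (v := g • e.origin)
      (w := g • e.terminus)
    have o1 : (L : ℝ) ≤ (graph φ).dist e.origin (g • e.origin) := Nat.cast_le.2 ho1
    have o2 : (L : ℝ) ≤ (graph φ).dist e.terminus (g • e.terminus) := Nat.cast_le.2 ht1
    have o3 : (L : ℝ) ≤ (graph φ).dist e.origin (g • e.terminus) + 1 := by norm_cast; omega
    have o4 : (L : ℝ) ≤ (graph φ).dist e.terminus (g • e.origin) + 1 := by norm_cast; omega
    refine ⟨le_min (sub_le_iff_le_add'.1 (le_min (by linarith) (by linarith)))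
      (sub_le_iff_le_add'.1 (le_min (by linarith) (by linarith))), fun h => ?_⟩
    suffices (graph φ).dist e.origin (g • e.terminus) + 1 ≤ L ∨
        (graph φ).dist e.terminus (g • e.origin) + 1 ≤ L by
      rcases this with h | h
      · exact exists_coord_edge hv s (ho2 (by omega)) (ht2 (by omega))
      · exact exists_coord_edge hv s (ho2 (by omega)) (ht2 (by omega))
    rcases min_le_iff.1 h with h | h
    · rw [← le_sub_iff_add_le', min_le_iff] at h
      rcases h with h | h
      · linarith
      · left
        have : ((graph φ).dist e.origin (g • e.terminus) : ℝ) + 1 ≤ L := by linarith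
        exact_mod_cast this
    · rw [← le_sub_iff_add_le', min_le_iff] at h
      rcases h with h | h
      · right
        have : ((graph φ).dist e.terminus (g • e.origin) : ℝ) + 1 ≤ L := by linarith
        exact_mod_cast this
      · linarith

theorem Coord.dist_smul_eq (hv : (graph φ).IsLine v) (hg : ∀ i, g • v i = v (i + L))
    {x : Tree φ} {u : ℝ} (h : Coord v x u) : dist x (g • x) = L := by
  rw [h.dist_eq hv (h.smul_add (n := L) hg)]
  simp

theorem mem_axis_iff (hv : (graph φ).IsLine v) (hL : 0 < L) (hg : ∀ i, g • v i = v (i + L))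
    {x : Tree φ} : x ∈ axis (Tree φ) g ↔ ∃ u, Coord v x u := by
  constructor
  · intro h
    refine (le_dist_smul hv hL hg x).2 ((h (.vertex (v 0))).trans_eq ?_)
    exact (coord_vertex v 0).dist_smul_eq hv hg
  · rintro ⟨u, hu⟩ y
    rw [hu.dist_smul_eq hv hg]
    exact (le_dist_smul hv hL hg y).1

theorem translationLength_eq (hv : (graph φ).IsLine v) (hL : 0 < L)
    (hg : ∀ i, g • v i = v (i + L)) : translationLength (Tree φ) g = L := by
  refine le_antisymm ((translationLength_le g (.vertex (v 0))).trans_eq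
    ((coord_vertex v 0).dist_smul_eq hv hg)) ?_
  have : Nonempty (Tree φ) := ⟨.vertex (v 0)⟩
  exact le_ciInf fun x => (le_dist_smul hv hL hg x).1

theorem axisLE_iff (hv : (graph φ).IsLine v) (hL : 0 < L) (hg : ∀ i, g • v i = v (i + L))
    {x y : Tree φ} {u w : ℝ} (hx : Coord v x u) (hy : Coord v y w) : AxisLE g x y ↔ u ≤ w := by
  have hmem : ∀ n : ℕ, y ∈ (OSeg.mk x (g ^ n • x)).carrier ↔
      |u - w| + |w - (u + (n * L : ℤ))| = |u - (u + (n * L : ℤ))| := by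
    intro n
    have h := hx.smul_add (g := g ^ n) (n := n * L) fun i => by
      simpa using Periodic.zpow_smul hg n i
    rw [← hx.dist_eq hv hy, ← hy.dist_eq hv h, ← hx.dist_eq hv h]
    rfl
  have hL' : (0 : ℝ) < L := by exact_mod_cast hL
  constructor
  · rintro ⟨-, -, n, hn⟩
    rw [hmem] at hn
    push_cast at hn
    by_contra! h
    have hnL : (0 : ℝ) ≤ n * L := by positivity
    rw [abs_of_pos (by linarith), abs_of_nonpos (by linarith), abs_of_nonpos (by linarith)] at hn
    linarith
  · intro h
    refine ⟨(mem_axis_iff hv hL hg).2 ⟨u, hx⟩, (mem_axis_iff hv hL hg).2 ⟨w, hy⟩, ?_⟩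
    obtain ⟨n, hn⟩ := exists_nat_ge ((w - u) / L)
    rw [div_le_iff₀ hL'] at hn
    refine ⟨n, ?_⟩
    rw [hmem]
    push_cast
    have hnL : (0 : ℝ) ≤ n * L := by positivity
    rw [abs_of_nonpos (by linarith), abs_of_nonpos (by linarith), abs_of_nonpos (by linarith)]
    ring

theorem reversesAxis_of_smul_eq (hv : (graph φ).IsLine v) (hL : 0 < L)
    (hg : ∀ i, g • v i = v (i + L)) {h : HNNExtension A C D φ} {R : ℤ}
    (hh : ∀ i, h • v i = v (R - i)) : ReversesAxis (Tree φ) h g := by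
  have hmem := fun x => mem_axis_iff hv hL hg (x := x)
  constructor
  · ext x
    constructor
    · rintro ⟨y, hy, rfl⟩
      obtain ⟨u, hu⟩ := (hmem y).1 hy
      exact (hmem _).2 ⟨_, hu.smul_sub hh⟩
    · intro hx
      obtain ⟨u, hu⟩ := (hmem x).1 hx
      refine ⟨h⁻¹ • x, (hmem _).2 ⟨_, hu.smul_sub (R := R) fun i => ?_⟩, smul_inv_smul h x⟩
      rw [inv_smul_eq_iff, hh, sub_sub_cancel]
  · intro x y hxy
    obtain ⟨u, hu⟩ := (hmem x).1 hxy.1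
    obtain ⟨w, hw⟩ := (hmem y).1 hxy.2.1
    rw [axisLE_iff hv hL hg hu hw] at hxy
    rw [axisLE_iff hv hL hg (hw.smul_sub hh) (hu.smul_sub hh)]
    linarith

end Shift

end

end BassSerre

/-! ### Counting copies of a segment in the circuit -/

namespace BassSerre

section

variable {A : Type*} [Group A] {C D : Subgroup A} {φ : C ≃* D}

open HNNExtension GTree

variable {v : ℤ → Vertex φ}

/-- The segment `[v a, v b]`. -/
def lineSeg (v : ℤ → Vertex φ) (a b : ℤ) : OSeg (Tree φ) := ⟨.vertex (v a), .vertex (v b)⟩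

theorem smul_lineSeg {g : HNNExtension A C D φ} {n : ℤ} (hg : ∀ i, g • v i = v (i + n))
    (a b : ℤ) : g • lineSeg v a b = lineSeg v (a + n) (b + n) :=
  OSeg.ext (congrArg Tree.vertex (hg a)) (congrArg Tree.vertex (hg b))

theorem Coord.mem_lineSeg_iff (hv : (graph φ).IsLine v) {a b : ℤ} (hab : a ≤ b) {x : Tree φ}
    {u : ℝ} (hx : Coord v x u) : x ∈ (lineSeg v a b).carrier ↔ a ≤ u ∧ u ≤ b := by
  have ha := (coord_vertex v a).dist_eq hv hx
  have hb := hx.dist_eq hv (coord_vertex v b)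
  have hab' := (coord_vertex v a).dist_eq hv (coord_vertex v b)
  change dist (Tree.vertex (v a)) x + dist x (Tree.vertex (v b)) =
    dist (Tree.vertex (v a)) (Tree.vertex (v b)) ↔ _
  rw [ha, hb, hab', abs_of_nonpos (sub_nonpos.2 (Int.cast_le.2 hab))]
  constructor
  · intro h
    have h1 := neg_le_abs (a - u)
    have h2 := le_abs_self (a - u)
    have h3 := neg_le_abs (u - b)
    have h4 := le_abs_self (u - b)
    constructor <;> linarith
  · rintro ⟨h1, h2⟩
    rw [abs_of_nonpos (by linarith), abs_of_nonpos (by linarith)]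
    ring

theorem exists_coord_of_mem_lineSeg (hv : (graph φ).IsLine v) {a b : ℤ} (hab : a ≤ b) {x : Tree φ}
    (hx : x ∈ (lineSeg v a b).carrier) : ∃ u : ℝ, Coord v x u ∧ a ≤ u ∧ u ≤ b := by
  obtain ⟨u, hu⟩ := exists_coord_of_mem_carrier hv hab hx
  exact ⟨u, hu, (hu.mem_lineSeg_iff hv hab).1 hx⟩

/-- With integral ends, segments sharing two points share a whole edge. -/
theorem overlap_lineSeg_iff (hv : (graph φ).IsLine v) {L : ℕ} (a b : ℤ) :
    (lineSeg v a (a + L)).Overlap (lineSeg v b (b + L)) ↔ (a - b).natAbs < L := by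
  constructor
  · rintro ⟨x, ⟨hx1, hx2⟩, y, ⟨hy1, hy2⟩, hne⟩
    obtain ⟨u, hu, hu1, hu2⟩ := exists_coord_of_mem_lineSeg hv (by omega) hx1
    obtain ⟨w, hw, hw1, hw2⟩ := exists_coord_of_mem_lineSeg hv (by omega) hy1
    rw [hu.mem_lineSeg_iff hv (by omega)] at hx2
    rw [hw.mem_lineSeg_iff hv (by omega)] at hy2
    by_contra! hlt
    have key : ∀ k : ℤ, u = k → w = k → False := by
      rintro k rfl rfl
      exact hne (hu.eq_vertex.trans hw.eq_vertex.symm)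
    have hab : a + L ≤ b ∨ b + L ≤ a := by omega
    rcases hab with h | h
    · have h' : ((a + L : ℤ) : ℝ) ≤ b := Int.cast_le.2 h
      exact key (a + L) (by linarith) (by linarith)
    · have h' : ((b + L : ℤ) : ℝ) ≤ a := Int.cast_le.2 h
      exact key a (by linarith) (by linarith)
  · intro h
    have hmem : ∀ i a : ℤ, a ≤ i → i ≤ a + L →
        Tree.vertex (v i) ∈ (lineSeg v a (a + L)).carrier := fun i a h1 h2 =>
      ((coord_vertex v i).mem_lineSeg_iff hv (by omega)).2 ⟨Int.cast_le.2 h1, Int.cast_le.2 h2⟩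
    refine ⟨_, ⟨hmem (max a b) a (by omega) (by omega), hmem (max a b) b (by omega) (by omega)⟩,
      _, ⟨hmem (max a b + 1) a (by omega) (by omega), hmem (max a b + 1) b (by omega) (by omega)⟩,
      fun heq => ?_⟩
    have := hv.injective (Tree.vertex.inj heq)
    omega

theorem smul_line_eq (hv : (graph φ).IsLine v) (h : HNNExtension A C D φ) (a b R : ℤ)
    (ha : h • v a = v (R - a)) (hb : h • v b = v (R - b)) (i : ℤ) (hai : a ≤ i) (hib : i ≤ b) :
    h • v i = v (R - i) := by
  refine hv.eq_of_dist graph_isTree (a := R - b) (b := R - a) (by omega) (by omega) ?_ ?_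
  · rw [← hb, dist_smul, hv]
    omega
  · rw [← ha, dist_smul, hv]
    omega

section Shift

variable {g : HNNExtension A C D φ} {L : ℕ}

theorem lineSeg_subset_axis (hv : (graph φ).IsLine v) (hL : 0 < L)
    (hg : ∀ i, g • v i = v (i + L)) {a b : ℤ} (hab : a ≤ b) :
    (lineSeg v a b).carrier ⊆ axis (Tree φ) g := fun _ hx =>
  (mem_axis_iff hv hL hg).2 (exists_coord_of_mem_carrier hv hab hx)

theorem exists_eq_of_vertex_mem_axis (hv : (graph φ).IsLine v) (hL : 0 < L)
    (hg : ∀ i, g • v i = v (i + L)) {w : Vertex φ} (hw : Tree.vertex w ∈ axis (Tree φ) g) :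
    ∃ i, w = v i := by
  obtain ⟨_, i, hi, -⟩ := (mem_axis_iff hv hL hg).1 hw
  exact ⟨i, hi⟩

/-- The group takes vertices to vertices, so copies of `[v a, v b]` sit at integral positions and
counting them is a discrete problem. -/
theorem eq_lineSeg_of_isPositiveCopy (hv : (graph φ).IsLine v) (hL : 0 < L)
    (hg : ∀ i, g • v i = v (i + L)) {a b : ℤ} {σ : OSeg (Tree φ)}
    (hσ : IsPositiveCopy g (lineSeg v a b) σ) :
    ∃ (h : HNNExtension A C D φ) (i : ℤ), h • v a = v i ∧ h • v b = v (i + (a - b).natAbs) ∧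
      σ = lineSeg v i (i + (a - b).natAbs) := by
  obtain ⟨⟨h, rfl⟩, -, hle⟩ := hσ
  obtain ⟨i, hi⟩ := exists_eq_of_vertex_mem_axis hv hL hg (w := h • v a) hle.1
  obtain ⟨j, hj⟩ := exists_eq_of_vertex_mem_axis hv hL hg (w := h • v b) hle.2.1
  have hseg : h • lineSeg v a b = lineSeg v i j :=
    OSeg.ext (congrArg Tree.vertex hi) (congrArg Tree.vertex hj)
  rw [hseg] at hle
  have hij := (axisLE_iff hv hL hg (coord_vertex v i) (coord_vertex v j)).1 hle
  rw [Int.cast_le] at hij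
  have hdist := dist_smul h (v a) (v b)
  rw [hi, hj, hv, hv] at hdist
  obtain rfl : j = i + (a - b).natAbs := by omega
  exact ⟨h, i, hi, hj, hseg⟩

theorem isPositiveCopy_lineSeg (hv : (graph φ).IsLine v) (hL : 0 < L)
    (hg : ∀ i, g • v i = v (i + L)) {h : HNNExtension A C D φ} {n a b : ℤ} (hab : a ≤ b)
    (hh : ∀ i, h • v i = v (i + n)) :
    IsPositiveCopy g (lineSeg v a b) (lineSeg v (a + n) (b + n)) :=
  ⟨⟨h, (smul_lineSeg hh a b).symm⟩, lineSeg_subset_axis hv hL hg (by omega),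
    (axisLE_iff hv hL hg (coord_vertex v _) (coord_vertex v _)).2 (Int.cast_le.2 (by omega))⟩

/-- Pairwise disjoint arcs of length `L` in a circle of length `n * L`. -/
theorem le_of_forall_not_overlap (hv : (graph φ).IsLine v) (hL : 0 < L) {n k : ℕ} (hn : 0 < n)
    (hg : ∀ i, g • v i = v (i + (n * L : ℕ))) (s : Fin k → ℤ)
    (hs : ∀ i j, i ≠ j → ∀ m : ℤ,
      ¬ (lineSeg v (s i) (s i + L)).Overlap (g ^ m • lineSeg v (s j) (s j + L))) : k ≤ n := by
  have hnL : 0 < n * L := Nat.mul_pos hn hL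
  have hnL' : L ≤ n * L := Nat.le_mul_of_pos_left L hn
  have : NeZero (n * L) := ⟨hnL.ne'⟩
  -- Each arc occupies `L` edges, recorded as residues modulo `n * L`; disjointness makes these `k *
  -- L` residues distinct.
  let F : Fin k × Fin L → ZMod (n * L) := fun p => ((s p.1 + (p.2 : ℕ) : ℤ) : ZMod (n * L))
  have hF : Function.Injective F := by
    rintro ⟨i, a⟩ ⟨j, b⟩ hab
    obtain ⟨m, hm⟩ := (ZMod.intCast_eq_intCast_iff_dvd_sub _ _ _).1 hab
    simp only at hm
    have ha := a.2
    have hb := b.2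
    obtain rfl : i = j := by
      by_contra hne
      refine hs i j hne (-m) ?_
      rw [smul_lineSeg (Periodic.zpow_smul hg (-m)), add_right_comm, overlap_lineSeg_iff hv, neg_mul,
        mul_comm m]
      omega
    have hm0 : m = 0 := by
      by_contra hne
      have h1 : ((n * L : ℕ) : ℤ) ≤ |((n * L : ℕ) : ℤ) * m| := by
        rw [abs_mul, Nat.abs_cast]
        exact le_mul_of_one_le_right (by omega) (Int.one_le_abs hne)
      have h2 : |((n * L : ℕ) : ℤ) * m| < L := abs_lt.2 ⟨by omega, by omega⟩
      omega
    rw [hm0, mul_zero] at hm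
    exact Prod.ext rfl (Fin.ext (by simp only; omega))
  have hcard := Fintype.card_le_of_injective F hF
  rw [Fintype.card_prod, Fintype.card_fin, Fintype.card_fin, ZMod.card] at hcard
  exact Nat.le_of_mul_le_mul_right hcard hL

theorem pow_smul_line (hg : ∀ i, g • v i = v (i + L)) (n : ℕ) (i : ℤ) :
    g ^ n • v i = v (i + (n * L : ℕ)) := by
  simpa using Periodic.zpow_smul hg n i

theorem isHyperbolic_and_length_le (hv : (graph φ).IsLine v) (hL : 0 < L)
    (hg : ∀ i, g • v i = v (i + L)) {n : ℕ} (hn : 0 < n) {a b : ℤ} (hab : (a - b).natAbs = L) :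
    IsHyperbolic (Tree φ) (g ^ n) ∧
      (lineSeg v a b).length ≤ translationLength (Tree φ) (g ^ n) := by
  have hnL : 0 < n * L := Nat.mul_pos hn hL
  have hlen : (lineSeg v a b).length = L := by
    change ((graph φ).dist (v a) (v b) : ℝ) = L
    rw [hv, hab]
  rw [IsHyperbolic, translationLength_eq hv hnL (pow_smul_line hg n), hlen]
  exact ⟨by exact_mod_cast hnL, by exact_mod_cast Nat.le_mul_of_pos_left L hn⟩

theorem copyCount_pow_eq (hv : (graph φ).IsLine v) (hL : 0 < L) (hg : ∀ i, g • v i = v (i + L))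
    (x : ℤ) {n : ℕ} (hn : 0 < n) : copyCount (lineSeg v x (x + L)) (g ^ n) = n := by
  have hnL : 0 < n * L := Nat.mul_pos hn hL
  have hgn := pow_smul_line hg n
  rw [copyCount, if_pos (isHyperbolic_and_length_le hv hL hg hn (by omega))]
  -- The translates of the segment by `g ^ i` for `i < n` tile the circuit of `g ^ n`.
  refine IsGreatest.csSup_eq ⟨⟨fun i => lineSeg v (x + (i * L : ℕ)) (x + L + (i * L : ℕ)),
    fun i => isPositiveCopy_lineSeg hv hnL hgn (by omega) (pow_smul_line hg i), ?_⟩, ?_⟩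
  · intro i j hij m
    change ¬ (lineSeg v (x + (i * L : ℕ)) (x + L + (i * L : ℕ))).Overlap
      ((g ^ n) ^ m • lineSeg v (x + (j * L : ℕ)) (x + L + (j * L : ℕ)))
    rw [smul_lineSeg (Periodic.zpow_smul hgn m), add_right_comm x (L : ℤ), add_right_comm x (L : ℤ),
      add_right_comm (x + _) (L : ℤ), overlap_lineSeg_iff hv, not_lt]
    have hne : (i : ℤ) - j - m * n ≠ 0 := by
      intro h
      have hi := i.2
      have hj := j.2
      have hm : m = 0 := by
        by_contra hm
        have h1 : (n : ℤ) ≤ |m * n| := by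
          rw [abs_mul, Nat.abs_cast]
          exact le_mul_of_one_le_left (by omega) (Int.one_le_abs hm)
        have h2 : |m * n| < n := abs_lt.2 ⟨by omega, by omega⟩
        omega
      rw [hm, zero_mul] at h
      exact hij (Fin.ext (by omega))
    have hdiff : x + ((i * L : ℕ) : ℤ) - (x + (j * L : ℕ) + m * (n * L : ℕ)) =
        ((i : ℤ) - j - m * n) * L := by
      push_cast; ring
    rw [hdiff, Int.natAbs_mul, Int.natAbs_natCast]
    exact Nat.le_mul_of_pos_left L (Int.natAbs_pos.2 hne)
  · rintro k ⟨σ, hσ, hσ'⟩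
    have h := fun i => eq_lineSeg_of_isPositiveCopy hv hnL hgn (hσ i)
    choose h s h1 h2 h3 using h
    have habs : (x - (x + L)).natAbs = L := by omega
    rw [habs] at h3
    refine le_of_forall_not_overlap hv hL hn hgn s fun i j hij m => ?_
    rw [← h3, ← h3]
    exact hσ' i j hij m

/-- A single positive copy of the reversed segment would already provide an element excluded by
`hx`. -/
theorem copyCount_reverse_pow_eq (hv : (graph φ).IsLine v) (hL : 0 < L)
    (hg : ∀ i, g • v i = v (i + L)) {x : ℤ}
    (hx : ¬ ∃ (h : HNNExtension A C D φ) (R : ℤ),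
      ∀ k : ℤ, x ≤ k → k ≤ x + L → h • v k = v (R - k))
    {n : ℕ} (hn : 0 < n) : copyCount (lineSeg v x (x + L)).reverse (g ^ n) = 0 := by
  have hnL : 0 < n * L := Nat.mul_pos hn hL
  have hgn := pow_smul_line hg n
  change copyCount (lineSeg v (x + L) x) (g ^ n) = 0
  rw [copyCount, if_pos (isHyperbolic_and_length_le hv hL hg hn (by omega))]
  refine IsGreatest.csSup_eq ⟨⟨fun i => i.elim0, fun i => i.elim0, fun i => i.elim0⟩, ?_⟩
  rintro k ⟨σ, hσ, -⟩
  by_contra! hk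
  obtain ⟨h, i, h1, h2, -⟩ := eq_lineSeg_of_isPositiveCopy hv hnL hgn (hσ ⟨0, hk⟩)
  refine hx ⟨h, i + (x + L), smul_line_eq hv h x (x + L) _ ?_ ?_⟩
  · rw [h2]
    congr 1
    omega
  · rw [h1]
    congr 1
    omega

theorem homogenizationEq_one (hv : (graph φ).IsLine v) (hL : 0 < L)
    (hg : ∀ i, g • v i = v (i + L)) {x : ℤ}
    (hx : ¬ ∃ (h : HNNExtension A C D φ) (R : ℤ),
      ∀ k : ℤ, x ≤ k → k ≤ x + L → h • v k = v (R - k)) :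
    HomogenizationEq (lineSeg v x (x + L)) g 1 := by
  refine tendsto_const_nhds.congr' ?_
  filter_upwards [Filter.eventually_gt_atTop 0] with n hn
  have hn' : (n : ℝ) ≠ 0 := by exact_mod_cast hn.ne'
  rw [copyDiff, copyCount_pow_eq hv hL hg x hn, copyCount_reverse_pow_eq hv hL hg hx hn,
    Nat.cast_zero, sub_zero, div_self hn']

end Shift

end

end BassSerre

theorem mainTheorem10 {A : Type*} [Group A] {C D : Subgroup A} (φ : C ≃* D)
    (hC : C ≤ Subgroup.center A) (hD : D ≤ Subgroup.center A)
    (g : HNNExtension A C D φ)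
    (hg : GTree.IsHyperbolic (BassSerre.Tree φ) g)
    (hexp : BassSerre.tExponent φ g = 1) :
    (∃ γ : GTree.OSeg (BassSerre.Tree φ),
      GTree.IsFundamentalDomain g γ ∧ GTree.HomogenizationEq γ g 1) ∨
    (∃ h : HNNExtension A C D φ, GTree.ReversesAxis (BassSerre.Tree φ) h g) := by
  open BassSerre in
  obtain ⟨L, v, hL, hv, hgv⟩ := exists_line hg hexp
  -- Only fundamental domains with vertex ends are tested; they suffice for the dichotomy.
  by_cases hrev : ∀ x : ℤ, ∃ (h : HNNExtension A C D φ) (R : ℤ),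
      ∀ k : ℤ, x ≤ k → k ≤ x + L → h • v k = v (R - k)
  · right
    obtain ⟨h, R, hR⟩ := Periodic.exists_reversal (P := fun i => height (v i)) hL hgv
      (fun i => by simp [← hgv, height_smul, hexp])
      (fun h => ⟨(tExponent φ h).toAdd, fun i j hij => by rw [← hij, height_smul, add_comm]⟩)
      (fun u a b i₀ j₀ => smul_eq_of_smul_eq_on hC hD hv.adj) (smul_line_eq hv) hrev
    exact ⟨h, reversesAxis_of_smul_eq hv hL hgv hR⟩
  · left
    rw [not_forall] at hrev
    obtain ⟨x, hx⟩ := hrev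
    exact ⟨lineSeg v x (x + L), ⟨lineSeg_subset_axis hv hL hgv (by omega),
      congrArg Tree.vertex (hgv x).symm⟩, homogenizationEq_one hv hL hgv hx⟩
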